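/- **Setting.** Let $(X,\mathcal S,\pi)$ be a probability space and let $\mathcal B$ be the Banach space of bounded measurable functions $w:X\to\mathbb C$ with norm $\|w\|=\sup_x|w_x|$. Write $\langle w\rangle=\int_X w_x\,\pi(dx)$, let $\|\cdot\|_2$ be the norm of $L^2=L^2(X,\pi)$, and let $\|T\|$ denote the norm of an operator $T:\mathcal B\to\mathcal B$. Let $a\in\mathcal B$ be real valued and let $S:\mathcal B\to\mathcal B$ be a bounded linear operator such that - **(A1)** $\int \overline{u}\,(Sw)\,d\pi=\int\overline{(Su)}\,w\,d\pi$ for all $u,w\in\mathcal B$, and $p\ge 0$ implies $Sp\ge 0$ for every $p\in\mathcal B$; - **(A2)** $S$ extends to a bounded operator $L^2\to\mathcal B$ which is given by $(Sw)_x=\int_X S_{xy}w_y\,\pi(dy)$ with a symmetric, measurable kernel $S_{xy}\in[0,\infty)$; its norm is denoted $\|S\|_{L^2\to\mathcal B}$; - **(A3)** there are an integer $L\ge 1$ and $\rho>0$ such that $(S^Lu)_x\ge\rho\langle u\rangle$ for all $x\in X$ and all $u\in\mathcal B$ with $u\ge 0$. Let $\mathbb C_+=\{z\in\mathbb C:\operatorname{Im}z>0\}$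 and let $m:\mathbb C_+\to\{w\in\mathcal B:\operatorname{Im}w_x>0\text{ for all }x\}$ be the solution of the quadratic vector equation $$-\frac1{m_x(z)}=z+a_x+(Sm(z))_x,\qquad x\in X,\ z\in\mathbb C_+ .$$ Put $\Sigma=\|a\|+2\|S\|^{1/2}$. For an interval $I\subset\mathbb R$ and $\varepsilon>0$ put $$\mathbb D=\{z\in\mathbb C_+:\operatorname{dist}(z,[-2\Sigma,2\Sigma]\setminus I)\ge\varepsilon\},\qquad \overline{\mathbb D}=\{z\in\mathbb C:\operatorname{Im}z\ge 0,\ \operatorname{dist}(z,[-2\Sigma,2\Sigma]\setminus I)\ge\varepsilon\},$$ where the distance to the empty set is $\infty$. **Proposition.** (i) Suppose that $\|m(z)\|_2\le\Lambda<\infty$ for all $z\in\mathbb C_+$ with $\operatorname{Re}z\in I$. Then $$|\langle m(z_1)\rangle-\langle m(z_2)\rangle|\le C\,|z_1-z_2|^{1/13},\qquad z_1,z_2\in\mathbb D,$$ where $C<\infty$ depends only on $L$, $\rho$, $\varepsilon$, $\Lambda$ and on upper bounds for $\|a\|$ and $\|S\|_{L^2\to\mathcal B}$. (ii) Suppose that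 $|||m|||_I:=\sup\{\|m(z)\|:\operatorname{Re}z\in I,\ \operatorname{Im}z>0\}\le\Phi<\infty$. Then $$\|m(z_1)-m(z_2)\|\le C\,|z_1-z_2|^{1/3},\qquad z_1,z_2\in\mathbb D,$$ where $C<\infty$ depends only on $L$, $\rho$, $\varepsilon$, $\Phi$ and on upper bounds for $\|a\|$ and $\|S\|_{L^2\to\mathcal B}$. Consequently $m|_{\mathbb D}$ has a continuous extension $\overline{\mathbb D}\to\mathcal B$, which includes the real points of $\overline{\mathbb D}$, and the extension satisfies the same bound on $\overline{\mathbb D}$, with the same $C$. In particular, if $I=\mathbb R$, then $m$ extends continuously to $\mathbb C_+\cup\mathbb R$. -/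

import Mathlib

open scoped ComplexOrder ENNReal
open MeasureTheory

noncomputable section

namespace QVE

/-- The Banach space of bounded measurable functions `X → ℂ`, with the supremum norm. -/
def BB (X : Type*) [MeasurableSpace X] : Submodule ℂ (lp (fun _ : X => ℂ) ⊤) where
  carrier := {w | Measurable fun x => w x}
  add_mem' := fun {u w} (hu : Measurable fun x => u x) (hw : Measurable fun x => w x) =>
    show Measurable fun x => (u + w) x from hu.add hw
  zero_mem' := show Measurable fun x => (0 : lp (fun _ : X => ℂ) ⊤) x from measurable_const
  smul_mem' := fun c w (hw : Measurable fun x => w x) =>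
    show Measurable fun x => (c • w) x from hw.const_smul c

instance (X : Type*) [MeasurableSpace X] : CoeFun (BB X) fun _ => X → ℂ :=
  ⟨fun w x => (w : lp (fun _ : X => ℂ) ⊤) x⟩

theorem BB.memLp {X : Type*} [MeasurableSpace X] (μ : Measure X) [IsFiniteMeasure μ]
    (p : ℝ≥0∞) (w : BB X) : MemLp (fun x => w x) p μ :=
  MemLp.of_bound (Measurable.aestronglyMeasurable w.2) ‖w‖
    (Filter.Eventually.of_forall fun x => lp.norm_apply_le_norm ENNReal.top_ne_zero w.1 x)

/-- The class in `L²(X, μ)` of a bounded measurable function. -/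
def BB.toL2 {X : Type*} [MeasurableSpace X] (μ : Measure X) [IsFiniteMeasure μ]
    (w : BB X) : Lp ℂ 2 μ :=
  (BB.memLp μ 2 w).toLp fun x => w x

/-- The average `⟨w⟩` of a bounded measurable function. -/
def avg {X : Type*} [MeasurableSpace X] (μ : Measure X) (w : BB X) : ℂ :=
  ∫ x, w x ∂μ

/-- A1: `S` is symmetric and positivity preserving. (In the order of `ℂ` used here, `0 ≤ c`
means that `c` is real and non-negative.) -/
structure SymmetricPositive {X : Type*} [MeasurableSpace X] (μ : Measure X)
    (S : BB X →L[ℂ] BB X) : Prop where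
  symm : ∀ u w : BB X,
    ∫ x, (starRingEnd ℂ) (u x) * S w x ∂μ = ∫ x, (starRingEnd ℂ) (S u x) * w x ∂μ
  pos : ∀ p : BB X, (∀ x, 0 ≤ p x) → ∀ x, 0 ≤ S p x

/-- A2: `S` extends to a bounded operator `T` from `L²` to `BB` that is represented by a
symmetric non-negative measurable kernel `k`, and the norm of this operator is at most `K`.
(The extension is unique, since `BB` is dense in `L²`.) -/
def SmoothingWith {X : Type*} [MeasurableSpace X] (μ : Measure X) [IsFiniteMeasure μ]
    (S : BB X →L[ℂ] BB X) (K : ℝ) : Prop :=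
  ∃ (T : Lp ℂ 2 μ →L[ℂ] BB X) (k : X → X → ℝ),
    (∀ w : BB X, T (BB.toL2 μ w) = S w) ∧
    ‖T‖ ≤ K ∧
    Measurable (Function.uncurry k) ∧
    (∀ x y, 0 ≤ k x y) ∧
    (∀ x y, k x y = k y x) ∧
    ∀ (w : Lp ℂ 2 μ) (x : X),
      Integrable (fun y => (k x y : ℂ) * w y) μ ∧ T w x = ∫ y, (k x y : ℂ) * w y ∂μ

/-- A3: `S` is uniformly primitive, with the parameters `L ≥ 1` and `ρ > 0`. -/
structure UniformlyPrimitive {X : Type*} [MeasurableSpace X] (μ : Measure X)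
    (S : BB X →L[ℂ] BB X) (L : ℕ) (ρ : ℝ) : Prop where
  one_le : 1 ≤ L
  pos : 0 < ρ
  le_pow : ∀ u : BB X, (∀ x, 0 ≤ u x) → ∀ x, (ρ : ℂ) * avg μ u ≤ (S ^ L) u x

/-- `m` solves the quadratic vector equation `-1 / m(z) = z + a + S m(z)` on the upper half
plane, with values in the functions with positive imaginary part. The values of `m` outside
the open upper half plane are irrelevant. -/
structure IsSolution {X : Type*} [MeasurableSpace X]
    (a : BB X) (S : BB X →L[ℂ] BB X) (m : ℂ → BB X) : Prop where
  im_pos : ∀ z : ℂ, 0 < z.im → ∀ x, 0 < (m z x).im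
  eqn : ∀ z : ℂ, 0 < z.im → ∀ x, -(1 / m z x) = z + a x + S (m z) x

/-- `Σ = ‖a‖ + 2 ‖S‖ ^ (1 / 2)`. -/
def Sig {X : Type*} [MeasurableSpace X] (a : BB X) (S : BB X →L[ℂ] BB X) : ℝ :=
  ‖a‖ + 2 * Real.sqrt ‖S‖

/-- The supremum of `‖w z‖` over `z` in the open upper half plane with real part in `I`. -/
def nnorm {X : Type*} [MeasurableSpace X] (w : ℂ → BB X) (I : Set ℝ) : ℝ≥0∞ :=
  ⨆ z : {z : ℂ // z.re ∈ I ∧ 0 < z.im}, ‖w z‖ₑ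

/-- The points of the open upper half plane at distance at least `ε` from
`[-2 s, 2 s] \ I` (every point has infinite distance from the empty set). -/
def domain (s : ℝ) (I : Set ℝ) (ε : ℝ) : Set ℂ :=
  {z | 0 < z.im ∧ ∀ τ ∈ Set.Icc (-(2 * s)) (2 * s) \ I, ε ≤ ‖z - (τ : ℂ)‖}

/-- The analogue of `domain` in the closed upper half plane. -/
def closedDomain (s : ℝ) (I : Set ℝ) (ε : ℝ) : Set ℂ :=
  {z | 0 ≤ z.im ∧ ∀ τ ∈ Set.Icc (-(2 * s)) (2 * s) \ I, ε ≤ ‖z - (τ : ℂ)‖}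

end QVE

end

/-! Write η = Im z, v = ⟨Im m⟩, s = Im m/|m| and F = |m| S |m|. The imaginary part of the equation
says F s = s - η|m| ≤ s. A symmetric positive operator with a positive supersolution is an
L²-contraction (Schur test, `Symm.schur`), so ‖F‖ ≤ 1 on L². Primitivity gives F^L ≥ δ |m|⟨|m|, ·⟩,
and the same test applied to the difference of the two sides yields a gap proportional to v/τ on the
complement of |m| (`SolutionBounds.gap`), where τ bounds η + S Im m.

For z' near z, the difference m(z) - m(z') = |m| w satisfies (m̄/m) w = F w + g with ‖g‖₂ ≲ |z - z'|
(`Setting.eventually_linearised`). There are two bounds on w. The term η|m| in F s gives ‖w‖₂ ≲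
(τ/η)‖g‖₂. On the other hand, split w = t s + w' with w' orthogonal to |m|: the gap controls w', and
|m̄/m - 1| = 2s shows that the phase moves the approximate eigenvector s, which controls t. If η is
small against powers of v, this gives a bound in negative powers of v alone
(`SolutionBounds.norm_le_of_dens`).

If m is bounded, then S Im m ≲ v, so τ is of order v and the two bounds become v/η and v⁻². They
balance at v ~ η^(1/3), which gives η^(-2/3), and S : L² → B lifts the estimate to the supremum
norm. If m is only bounded in L², the average obeys the bounds √v/η and v⁻⁵, and splitting at v ~
η^(2/13) gives η^(-12/13).

A local Lipschitz constant of order (Im z)^(-θ) integrates to Hölder continuity of order 1 - θ along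
a path that goes up, across and down (`holder_of_local`). In the rest of the domain, either Im z is
bounded below and |m| ≤ 1/Im z, or |z| ≥ 2Σ, where m is small by a continuity argument. The
continuity of m inside the half plane, needed for the linearisation, comes from a contraction in the
hyperbolic metric (`IsSolution.contraction`). -/

noncomputable section

namespace QVE

variable {X : Type*} [MeasurableSpace X]

/-! ### Bounded measurable functions and their L²-norms -/

namespace BB

/-- The element of `BB X` given by a bounded measurable function. -/
def mk (f : X → ℂ) (hf : Measurable f) (hb : ∃ C, ∀ x, ‖f x‖ ≤ C) : BB X :=
  ⟨⟨f, memℓp_infty (hb.imp fun C hC => by rintro _ ⟨x, rfl⟩; exact hC x)⟩, hf⟩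

@[simp] theorem mk_apply (f : X → ℂ) (hf : Measurable f) (hb : ∃ C, ∀ x, ‖f x‖ ≤ C) (x : X) :
    (mk f hf hb) x = f x := rfl

theorem ext_apply {u w : BB X} (h : ∀ x, u x = w x) : u = w :=
  Subtype.ext (lp.ext (funext h))

@[simp] theorem add_apply (u w : BB X) (x : X) : (u + w) x = u x + w x := rfl
@[simp] theorem sub_apply (u w : BB X) (x : X) : (u - w) x = u x - w x := rfl
@[simp] theorem smul_apply (c : ℂ) (u : BB X) (x : X) : (c • u) x = c * u x := rfl
@[simp] theorem lp_smul_apply {X : Type*} (c : ℂ) (u : lp (fun _ : X => ℂ) ⊤) (x : X) :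
    (c • u) x = c * u x := rfl

theorem meas (u : BB X) : Measurable fun x => u x := u.2

theorem norm_apply_le (u : BB X) (x : X) : ‖u x‖ ≤ ‖u‖ :=
  lp.norm_apply_le_norm ENNReal.top_ne_zero u.1 x

theorem norm_le {u : BB X} {C : ℝ} (hC : 0 ≤ C) (h : ∀ x, ‖u x‖ ≤ C) : ‖u‖ ≤ C :=
  lp.norm_le_of_forall_le hC h

/-- The pointwise product. -/
def mul (u w : BB X) : BB X :=
  mk (fun x => u x * w x) ((meas u).mul (meas w)) ⟨‖u‖ * ‖w‖, fun x => by
    rw [norm_mul]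
    exact mul_le_mul (norm_apply_le u x) (norm_apply_le w x) (norm_nonneg _) (norm_nonneg _)⟩

@[simp] theorem mul_apply (u w : BB X) (x : X) : (mul u w) x = u x * w x := rfl

/-- The pointwise complex conjugate. -/
def conj (u : BB X) : BB X :=
  mk (fun x => (starRingEnd ℂ) (u x)) (Complex.continuous_conj.measurable.comp (meas u))
    ⟨‖u‖, fun x => by simpa using norm_apply_le u x⟩

@[simp] theorem conj_apply (u : BB X) (x : X) : (conj u) x = (starRingEnd ℂ) (u x) := rfl

/-- A bounded measurable real function as an element of `BB X`. -/
def ofReal (f : X → ℝ) (hf : Measurable f) (hb : ∃ C, ∀ x, |f x| ≤ C) : BB X :=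
  mk (fun x => (f x : ℂ)) (Complex.measurable_ofReal.comp hf)
    (hb.imp fun C hC x => by simpa using hC x)

@[simp] theorem ofReal_apply (f : X → ℝ) (hf : Measurable f) (hb : ∃ C, ∀ x, |f x| ≤ C) (x : X) :
    (ofReal f hf hb) x = (f x : ℂ) := rfl

/-- The constant functions. -/
def const (c : ℂ) : BB X := mk (fun _ => c) measurable_const ⟨‖c‖, fun _ => le_rfl⟩

@[simp] theorem const_apply (c : ℂ) (x : X) : (const c : BB X) x = c := rfl

/-- The pointwise absolute value. -/
def abs (u : BB X) : BB X :=
  ofReal (fun x => ‖u x‖) (meas u).norm ⟨‖u‖, fun x => by simpa using norm_apply_le u x⟩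

@[simp] theorem abs_apply (u : BB X) (x : X) : (abs u) x = (‖u x‖ : ℂ) := rfl

/-- The pointwise imaginary part. -/
def imag (u : BB X) : BB X :=
  ofReal (fun x => (u x).im) (Complex.measurable_im.comp (meas u))
    ⟨‖u‖, fun x => (Complex.abs_im_le_norm _).trans (norm_apply_le u x)⟩

@[simp] theorem imag_apply (u : BB X) (x : X) : (imag u) x = ((u x).im : ℂ) := rfl

/-- Pointwise multiplication by a fixed element, as a linear map. -/
def mulLeft (r : BB X) : BB X →ₗ[ℂ] BB X where
  toFun := mul r
  map_add' u w := ext_apply fun x => by simp [mul_add]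
  map_smul' c u := ext_apply fun x => by simp [mul_left_comm]

instance : CompleteSpace (BB X) := by
  refine IsClosed.completeSpace_coe (hs := ?_)
  refine IsSeqClosed.isClosed fun u w hu huw => ?_
  refine measurable_of_tendsto_metrizable (f := fun n x => u n x) (fun n => hu n) ?_
  rw [tendsto_pi_nhds]
  intro x
  rw [tendsto_iff_norm_sub_tendsto_zero] at huw ⊢
  exact squeeze_zero (fun _ => norm_nonneg _)
    (fun n => lp.norm_apply_le_norm ENNReal.top_ne_zero (u n - w) x) huw

section L2

variable (μ : Measure X) [IsFiniteMeasure μ]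

theorem integrable (u : BB X) : Integrable (fun x => u x) μ :=
  memLp_one_iff_integrable.1 (BB.memLp μ 1 u)

theorem toL2_add (u w : BB X) : toL2 μ (u + w) = toL2 μ u + toL2 μ w := rfl
theorem toL2_sub (u w : BB X) : toL2 μ (u - w) = toL2 μ u - toL2 μ w := rfl
theorem toL2_smul (c : ℂ) (u : BB X) : toL2 μ (c • u) = c • toL2 μ u := rfl

theorem inner_toL2 (u w : BB X) :
    inner ℂ (toL2 μ u) (toL2 μ w) = ∫ x, (starRingEnd ℂ) (u x) * w x ∂μ := by
  rw [L2.inner_def]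
  refine integral_congr_ae ?_
  filter_upwards [(BB.memLp μ 2 u).coeFn_toLp, (BB.memLp μ 2 w).coeFn_toLp] with x hu hw
  simp only [toL2, hu, hw]
  simp [mul_comm]

theorem norm_toL2_sq (u : BB X) : ‖toL2 μ u‖ ^ 2 = ∫ x, ‖u x‖ ^ 2 ∂μ := by
  have h2 : ∀ x, (starRingEnd ℂ) (u x) * u x = ((‖u x‖ ^ 2 : ℝ) : ℂ) := fun x => by
    rw [Complex.conj_mul']; simp
  rw [norm_sq_eq_re_inner (𝕜 := ℂ), inner_toL2]
  simp only [h2]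
  rw [integral_complex_ofReal]
  simp

theorem integrable_real {f : X → ℝ} (hf : Measurable f) (hb : ∃ C, ∀ x, |f x| ≤ C) :
    Integrable f μ := by
  obtain ⟨C, hC⟩ := hb
  exact Integrable.of_bound hf.aestronglyMeasurable C (Filter.Eventually.of_forall hC)

theorem integrable_norm_sq (u : BB X) : Integrable (fun x => ‖u x‖ ^ 2) μ :=
  integrable_real μ ((meas u).norm.pow_const 2) ⟨‖u‖ ^ 2, fun x => by
    rw [abs_of_nonneg (by positivity)]
    exact pow_le_pow_left₀ (norm_nonneg _) (norm_apply_le u x) 2⟩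

/-- Monotonicity of the `L²`-norm. -/
theorem norm_toL2_le {u w : BB X} {c : ℝ} (hc : 0 ≤ c) (h : ∀ x, ‖u x‖ ≤ c * ‖w x‖) :
    ‖toL2 μ u‖ ≤ c * ‖toL2 μ w‖ := by
  refine le_of_sq_le_sq ?_ (by positivity)
  rw [mul_pow, norm_toL2_sq, norm_toL2_sq, ← integral_const_mul]
  refine integral_mono (integrable_norm_sq μ u) ((integrable_norm_sq μ w).const_mul _) fun x => ?_
  simp only
  rw [← mul_pow]
  exact pow_le_pow_left₀ (norm_nonneg _) (h x) 2

theorem norm_toL2_mono {u w : BB X} (h : ∀ x, ‖u x‖ ≤ ‖w x‖) : ‖toL2 μ u‖ ≤ ‖toL2 μ w‖ := by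
  simpa using norm_toL2_le μ zero_le_one (u := u) (w := w) (by simpa using h)

theorem norm_integral_mul_le (u w : BB X) : ‖∫ x, u x * w x ∂μ‖ ≤ ‖toL2 μ u‖ * ‖toL2 μ w‖ := by
  have h := norm_inner_le_norm (𝕜 := ℂ) (toL2 μ (conj u)) (toL2 μ w)
  rw [inner_toL2] at h
  simp only [conj_apply, Complex.conj_conj] at h
  exact h.trans (mul_le_mul_of_nonneg_right (norm_toL2_mono μ (by simp)) (norm_nonneg _))

theorem norm_toL2_le_norm [IsProbabilityMeasure μ] (u : BB X) : ‖toL2 μ u‖ ≤ ‖u‖ := by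
  refine le_of_sq_le_sq ?_ (norm_nonneg _)
  rw [norm_toL2_sq]
  have := integral_mono (integrable_norm_sq μ u) (integrable_const (‖u‖ ^ 2) (μ := μ)) fun x =>
    pow_le_pow_left₀ (norm_nonneg _) (norm_apply_le u x) 2
  beta_reduce
  simpa using this

end L2

end BB

/-! ### Positive operators -/

/-- A positivity preserving linear operator. -/
def Positive (G : BB X →ₗ[ℂ] BB X) : Prop :=
  ∀ p : BB X, (∀ x, 0 ≤ p x) → ∀ x, 0 ≤ G p x

/-- A linear operator that is symmetric in `L²`. -/
def Symm (μ : Measure X) (G : BB X →ₗ[ℂ] BB X) : Prop :=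
  ∀ u w : BB X,
    ∫ x, (starRingEnd ℂ) (u x) * G w x ∂μ = ∫ x, (starRingEnd ℂ) (G u x) * w x ∂μ

namespace Positive

variable {G : BB X →ₗ[ℂ] BB X}

theorem mono (hG : Positive G) {u w : BB X} (h : ∀ x, u x ≤ w x) (x : X) : G u x ≤ G w x := by
  have h1 := hG (w - u) (fun y => by simpa using h y) x
  rw [map_sub] at h1
  simpa using h1

/-- Adding the constant ‖u‖ makes a real function non-negative, and positivity in the order of `ℂ`
includes being real. -/
theorem im_eq_zero (hG : Positive G) {u : BB X} (h : ∀ x, (u x).im = 0) (x : X) :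
    (G u x).im = 0 := by
  have h1 := hG (u + BB.const (‖u‖ : ℂ)) (fun y => by
    rw [Complex.nonneg_iff]
    have h2 := (abs_le.1 ((Complex.abs_re_le_norm _).trans (BB.norm_apply_le u y))).1
    simp only [BB.add_apply, BB.const_apply, Complex.add_re, Complex.ofReal_re, Complex.add_im,
      Complex.ofReal_im]
    exact ⟨by linarith, by simp [h y]⟩) x
  have h3 := hG (BB.const (‖u‖ : ℂ)) (fun y => by simp) x
  rw [map_add] at h1
  rw [Complex.nonneg_iff] at h1 h3
  have h4 := h1.2
  simp only [BB.add_apply, Complex.add_im] at h4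
  linarith [h3.2]

theorem map_conj (hG : Positive G) (u : BB X) (x : X) :
    G (BB.conj u) x = (starRingEnd ℂ) (G u x) := by
  have h1 := hG.im_eq_zero (u := u + BB.conj u) (fun y => by simp) x
  have h2 := hG.im_eq_zero (u := Complex.I • (u - BB.conj u)) (fun y => by simp) x
  rw [map_add] at h1
  rw [map_smul, map_sub] at h2
  simp at h1 h2
  apply Complex.ext
  · simp; linarith
  · simp; linarith

theorem map_imag (hG : Positive G) (u : BB X) (x : X) :
    G (BB.imag u) x = ((G u x).im : ℂ) := by
  have h : BB.imag u = (-Complex.I / 2) • (u - BB.conj u) := BB.ext_apply fun y => by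
    apply Complex.ext
    · simp; ring
    · simp
  rw [h, map_smul, map_sub]
  simp only [BB.smul_apply, BB.sub_apply, hG.map_conj]
  apply Complex.ext
  · simp; ring
  · simp

theorem apply_eq_re (hG : Positive G) {u : BB X} (h : ∀ x, (u x).im = 0) (x : X) :
    G u x = ((G u x).re : ℂ) :=
  Complex.ext (by simp) (by simp [hG.im_eq_zero h x])

/-- No kernel is needed: with c the unimodular number that turns (G u)(x) into its modulus, apply
positivity to 2|u| - 2 Re(c u) and evaluate at x. -/
theorem norm_le_abs (hG : Positive G) (u : BB X) (x : X) :
    ‖G u x‖ ≤ (G (BB.abs u) x).re := by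
  by_cases h0 : G u x = 0
  · rw [h0, norm_zero]
    exact (Complex.nonneg_iff.1 (hG (BB.abs u) (fun y => by simp) x)).1
  have hn : ‖G u x‖ ≠ 0 := by simpa using h0
  set c : ℂ := (starRingEnd ℂ) (G u x) / (‖G u x‖ : ℂ) with hc
  have hcn : ‖c‖ = 1 := by simp [hc, hn]
  have h1 := hG (BB.abs u + BB.abs u - c • u - BB.conj (c • u)) (fun y => by
    rw [Complex.nonneg_iff]
    have := Complex.re_le_norm (c * u y)
    rw [norm_mul, hcn, one_mul] at this
    constructor
    · simp only [BB.add_apply, BB.sub_apply, BB.smul_apply, BB.conj_apply, BB.abs_apply,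
        Complex.sub_re, Complex.add_re, Complex.ofReal_re, Complex.conj_re]
      linarith
    · simp only [BB.add_apply, BB.sub_apply, BB.smul_apply, BB.conj_apply, BB.abs_apply,
        Complex.sub_im, Complex.add_im, Complex.ofReal_im, Complex.conj_im]
      ring) x
  rw [map_sub, map_sub, map_add] at h1
  simp only [BB.add_apply, BB.sub_apply, hG.map_conj, map_smul] at h1
  have h2 := (Complex.nonneg_iff.1 h1).1
  have h3 : c * G u x = (‖G u x‖ : ℂ) := by
    have : (‖G u x‖ : ℂ) ≠ 0 := by exact_mod_cast hn
    rw [hc, div_mul_eq_mul_div, Complex.conj_mul', sq, mul_div_assoc, div_self this, mul_one]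
  simp only [BB.smul_apply, h3, Complex.sub_re, Complex.add_re, Complex.conj_ofReal,
    Complex.ofReal_re] at h2
  linarith

/-- The pointwise Cauchy-Schwarz inequality behind the Schur test. -/
theorem norm_sq_le (hG : Positive G) {h q w : BB X} {f g : X → ℝ}
    (hf : ∀ x, h x = (f x : ℂ)) (hg : ∀ x, G h x = (g x : ℂ)) (hpos : ∀ x, 0 < f x)
    (hgf : ∀ x, g x ≤ f x) (hq : ∀ x, q x = ((‖w x‖ ^ 2 / f x : ℝ) : ℂ)) (x : X) :
    ‖G w x‖ ^ 2 ≤ f x * (G q x).re := by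
  set s : ℂ := G w x / (f x : ℂ) with hs
  -- The argument is |w - s f|²/f ≥ 0 expanded, where q = |w|²/f. The value s = (G w)(x)/f(x) is the
  -- one that gives the inequality at the point x.
  have h1 := hG (q - (starRingEnd ℂ) s • w - BB.conj ((starRingEnd ℂ) s • w)
      + ((‖s‖ ^ 2 : ℝ) : ℂ) • h) (fun y => by
    have h2 : (q - (starRingEnd ℂ) s • w - BB.conj ((starRingEnd ℂ) s • w)
      + ((‖s‖ ^ 2 : ℝ) : ℂ) • h) y = ((‖w y - s * f y‖ ^ 2 / f y : ℝ) : ℂ) := by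
      have hfy : (f y : ℂ) ≠ 0 := by exact_mod_cast (hpos y).ne'
      simp only [BB.add_apply, BB.sub_apply, BB.smul_apply, BB.conj_apply, hf, hq]
      push_cast
      rw [← Complex.conj_mul' (w y - s * f y), ← Complex.conj_mul' s, ← Complex.conj_mul' (w y)]
      simp only [map_sub, map_mul, Complex.conj_conj, Complex.conj_ofReal]
      field_simp
      ring
    rw [h2]
    have := (hpos y).le
    exact Complex.zero_le_real.2 (by positivity : 0 ≤ ‖w y - s * f y‖ ^ 2 / f y)) x
  rw [map_add, map_sub, map_sub] at h1
  simp only [BB.add_apply, BB.sub_apply, hG.map_conj, map_smul, BB.smul_apply, hg] at h1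
  have hfx := hpos x
  have hfx' : (f x : ℂ) ≠ 0 := by exact_mod_cast hfx.ne'
  have h3 : (starRingEnd ℂ) s * G w x = ((‖G w x‖ ^ 2 / f x : ℝ) : ℂ) := by
    rw [hs, map_div₀, Complex.conj_ofReal, div_mul_eq_mul_div, Complex.conj_mul']
    push_cast; rfl
  have h4 : ‖s‖ ^ 2 = ‖G w x‖ ^ 2 / f x ^ 2 := by
    rw [hs, norm_div, div_pow, Complex.norm_real, Real.norm_eq_abs, sq_abs]
  rw [h3, Complex.conj_ofReal, h4] at h1
  have h5 := (Complex.nonneg_iff.1 h1).1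
  rw [← Complex.ofReal_mul, Complex.add_re, Complex.sub_re, Complex.sub_re, Complex.ofReal_re,
    Complex.ofReal_re] at h5
  have h6 : ‖G w x‖ ^ 2 / f x ^ 2 * g x ≤ ‖G w x‖ ^ 2 / f x ^ 2 * f x :=
    mul_le_mul_of_nonneg_left (hgf x) (by positivity)
  have h7 : ‖G w x‖ ^ 2 / f x ^ 2 * f x = ‖G w x‖ ^ 2 / f x := by field_simp
  have h8 : ‖G w x‖ ^ 2 / f x ≤ (G q x).re := by linarith
  rw [div_le_iff₀ hfx] at h8
  linarith

theorem pow_mono {n : ℕ} (hG : Positive G) : Positive (G ^ n) := by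
  induction n with
  | zero => exact fun p hp => hp
  | succ n ih => rw [pow_succ']; exact fun p hp => hG _ (ih p hp)

end Positive

/-! ### Schur test, powers and rank one perturbations -/

section L2

variable {μ : Measure X} [IsFiniteMeasure μ] {G : BB X →ₗ[ℂ] BB X}

theorem Symm.inner (hG : Symm μ G) (u w : BB X) :
    inner ℂ (BB.toL2 μ u) (BB.toL2 μ (G w)) = inner ℂ (BB.toL2 μ (G u)) (BB.toL2 μ w) := by
  rw [BB.inner_toL2, BB.inner_toL2]
  exact hG u w

/-- The Schur test for a symmetric positivity preserving operator `G` and a positive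
function `f` with `G f = g ≤ f`. -/
theorem Symm.schur (hS : Symm μ G) (hG : Positive G) {h : BB X} {f g : X → ℝ} {c : ℝ}
    (hf : ∀ x, h x = (f x : ℂ)) (hg : ∀ x, G h x = (g x : ℂ)) (hc : 0 < c) (hcf : ∀ x, c ≤ f x)
    (hgf : ∀ x, g x ≤ f x) (w : BB X) :
    ‖BB.toL2 μ (G w)‖ ^ 2 ≤ ∫ x, g x / f x * ‖w x‖ ^ 2 ∂μ := by
  have hpos : ∀ x, 0 < f x := fun x => hc.trans_le (hcf x)
  have hfm : Measurable f := by
    have : f = fun x => (h x).re := by ext x; simp [hf]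
    rw [this]; exact Complex.measurable_re.comp (BB.meas h)
  set q : BB X := BB.ofReal (fun x => ‖w x‖ ^ 2 / f x) (((BB.meas w).norm.pow_const 2).div hfm)
    ⟨‖w‖ ^ 2 / c, fun x => by
      rw [abs_of_nonneg (div_nonneg (by positivity) (hpos x).le)]
      exact div_le_div₀ (by positivity)
        (pow_le_pow_left₀ (norm_nonneg _) (BB.norm_apply_le w x) 2) hc (hcf x)⟩ with hq
  have h1 := fun x => hG.norm_sq_le (h := h) (q := q) (w := w) hf hg hpos hgf (fun _ => rfl) x
  have hqr : ∀ x, G q x = ((G q x).re : ℂ) := hG.apply_eq_re (fun x => Complex.ofReal_im _)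
  have h2 : (fun x => (starRingEnd ℂ) (h x) * G q x) =
      fun x => ((f x * (G q x).re : ℝ) : ℂ) := by
    ext x; rw [hqr x]; simp [hf]
  have h3 : (fun x => (starRingEnd ℂ) (G h x) * q x) =
      fun x => ((g x / f x * ‖w x‖ ^ 2 : ℝ) : ℂ) := by
    ext x; simp [hg, hq]; ring
  -- Symmetry moves G from q = |w|²/f onto f, which turns the integrated pointwise inequality into
  -- the weight g/f.
  have h4 := hS h q
  rw [h2, h3, integral_complex_ofReal, integral_complex_ofReal] at h4
  have h5 : ∫ x, f x * (G q x).re ∂μ = ∫ x, g x / f x * ‖w x‖ ^ 2 ∂μ := by exact_mod_cast h4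
  rw [← h5, BB.norm_toL2_sq]
  refine integral_mono (BB.integrable_norm_sq μ _) ?_ h1
  have := (BB.integrable μ (BB.mul h (G q))).re
  refine this.congr (Filter.Eventually.of_forall fun x => ?_)
  simp [hf]

/-- Expanding ‖u - G²u‖² ≥ 0 with G symmetric shows that the defects ‖Gʲw‖² - ‖Gʲ⁺¹w‖² do not
increase in j. The sum of the first n is therefore at most n times the first. This transfers a gap
of a power of G to G itself. -/
theorem Symm.norm_sq_sub_pow_le (hG : Symm μ G) (w : BB X) (n : ℕ) :
    ‖BB.toL2 μ w‖ ^ 2 - ‖BB.toL2 μ ((G ^ n) w)‖ ^ 2 ≤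
      n * (‖BB.toL2 μ w‖ ^ 2 - ‖BB.toL2 μ (G w)‖ ^ 2) := by
  have key : ∀ u : BB X, ‖BB.toL2 μ (G u)‖ ^ 2 - ‖BB.toL2 μ (G (G u))‖ ^ 2 ≤
      ‖BB.toL2 μ u‖ ^ 2 - ‖BB.toL2 μ (G u)‖ ^ 2 := fun u => by
    have h1 := norm_sub_sq (𝕜 := ℂ) (BB.toL2 μ u) (BB.toL2 μ (G (G u)))
    rw [hG.inner, inner_self_eq_norm_sq_to_K] at h1
    have h2 : RCLike.re ((‖BB.toL2 μ (G u)‖ : ℂ) ^ 2) = ‖BB.toL2 μ (G u)‖ ^ 2 := by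
      rw [← Complex.ofReal_pow]; exact Complex.ofReal_re _
    erw [h2] at h1
    nlinarith [sq_nonneg ‖BB.toL2 μ u - BB.toL2 μ (G (G u))‖]
  have step : ∀ n, ‖BB.toL2 μ ((G ^ n) w)‖ ^ 2 - ‖BB.toL2 μ ((G ^ (n + 1)) w)‖ ^ 2 ≤
      ‖BB.toL2 μ w‖ ^ 2 - ‖BB.toL2 μ (G w)‖ ^ 2 := by
    intro n
    induction n with
    | zero => simp
    | succ n ih =>
      refine le_trans ?_ ih
      have := key ((G ^ n) w)
      rwa [← Module.End.mul_apply, ← pow_succ', ← Module.End.mul_apply, ← pow_succ'] at this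
  induction n with
  | zero => simp
  | succ n ih =>
    have := step n
    push_cast
    linarith

end L2

section Closure

variable {μ : Measure X} [IsFiniteMeasure μ] {G H : BB X →ₗ[ℂ] BB X}

theorem symm_iff_inner : Symm μ G ↔ ∀ u w : BB X,
    inner ℂ (BB.toL2 μ u) (BB.toL2 μ (G w)) = inner ℂ (BB.toL2 μ (G u)) (BB.toL2 μ w) := by
  simp only [BB.inner_toL2]; rfl

theorem Symm.pow (hG : Symm μ G) (n : ℕ) : Symm μ (G ^ n) := by
  rw [symm_iff_inner]
  induction n with
  | zero => exact fun u w => rfl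
  | succ n ih =>
    intro u w
    have h1 : (G ^ (n + 1)) w = G ((G ^ n) w) := by rw [pow_succ']; rfl
    have h2 : (G ^ (n + 1)) u = (G ^ n) (G u) := by rw [pow_succ]; rfl
    rw [h1, h2, hG.inner, ih]

theorem Symm.sub (hG : Symm μ G) (hH : Symm μ H) : Symm μ (G - H) := by
  rw [symm_iff_inner]
  intro u w
  rw [LinearMap.sub_apply, LinearMap.sub_apply, BB.toL2_sub, BB.toL2_sub, inner_sub_right,
    inner_sub_left, hG.inner, hH.inner]

/-- The compression `r S r` of an operator by a multiplication operator. -/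
def sandwich (r : BB X) (S : BB X →ₗ[ℂ] BB X) : BB X →ₗ[ℂ] BB X :=
  BB.mulLeft r ∘ₗ S ∘ₗ BB.mulLeft r

theorem sandwich_apply (r : BB X) (S : BB X →ₗ[ℂ] BB X) (u : BB X) (x : X) :
    sandwich r S u x = r x * S (BB.mul r u) x := rfl

theorem Positive.sandwich (hG : Positive G) {r : BB X} (hr : ∀ x, 0 ≤ r x) :
    Positive (sandwich r G) := fun p hp x => by
  rw [sandwich_apply]
  exact mul_nonneg (hr x) (hG _ (fun y => mul_nonneg (hr y) (hp y)) x)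

omit [IsFiniteMeasure μ] in
theorem Symm.sandwich (hG : Symm μ G) {r : BB X} (hr : ∀ x, (starRingEnd ℂ) (r x) = r x) :
    Symm μ (sandwich r G) := fun u w => by
  have h := hG (BB.mul r u) (BB.mul r w)
  simp only [sandwich_apply, map_mul, hr, BB.mul_apply] at h ⊢
  convert h using 2 <;> · ext x; ring

/-- The operator `w ↦ δ ⟨r, w⟩ r`. -/
def rankOne (μ : Measure X) [IsFiniteMeasure μ] (δ : ℝ) (r : BB X) : BB X →ₗ[ℂ] BB X where
  toFun w := ((δ : ℂ) * inner ℂ (BB.toL2 μ r) (BB.toL2 μ w)) • r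
  map_add' u w := by rw [BB.toL2_add, inner_add_right, mul_add, add_smul]
  map_smul' c w := by
    rw [BB.toL2_smul, inner_smul_right, RingHom.id_apply, smul_smul, mul_left_comm]

theorem rankOne_apply (δ : ℝ) (r w : BB X) (x : X) :
    rankOne μ δ r w x = (δ : ℂ) * inner ℂ (BB.toL2 μ r) (BB.toL2 μ w) * r x := rfl

theorem rankOne_symm (δ : ℝ) (r : BB X) : Symm μ (rankOne μ δ r) := by
  rw [symm_iff_inner]
  intro u w
  change inner ℂ _ (((δ : ℂ) * inner ℂ (BB.toL2 μ r) (BB.toL2 μ w)) • BB.toL2 μ r) =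
    inner ℂ (((δ : ℂ) * inner ℂ (BB.toL2 μ r) (BB.toL2 μ u)) • BB.toL2 μ r) _
  rw [inner_smul_right, inner_smul_left, map_mul, Complex.conj_ofReal, inner_conj_symm]
  ring

theorem Symm.schur_le (hS : Symm μ G) (hG : Positive G) {h : BB X} {f g : X → ℝ} {c θ : ℝ}
    (hf : ∀ x, h x = (f x : ℂ)) (hg : ∀ x, G h x = (g x : ℂ)) (hc : 0 < c) (hcf : ∀ x, c ≤ f x)
    (hθ : θ ≤ 1) (hgf : ∀ x, g x ≤ θ * f x) (w : BB X) :
    ‖BB.toL2 μ (G w)‖ ^ 2 ≤ θ * ‖BB.toL2 μ w‖ ^ 2 := by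
  have hpos : ∀ x, 0 < f x := fun x => hc.trans_le (hcf x)
  refine (hS.schur hG hf hg hc hcf (fun x => (hgf x).trans ?_) w).trans ?_
  · nlinarith [hpos x]
  rw [BB.norm_toL2_sq, ← integral_const_mul]
  refine integral_mono_of_nonneg (Filter.Eventually.of_forall fun x => ?_)
    ((BB.integrable_norm_sq μ w).const_mul _) (Filter.Eventually.of_forall fun x => ?_)
  · have : 0 ≤ g x := by
      have := hG h (fun y => by rw [hf]; exact Complex.zero_le_real.2 (hpos y).le) x
      rw [hg] at this
      exact Complex.zero_le_real.1 this
    exact mul_nonneg (div_nonneg this (hpos x).le) (sq_nonneg _)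
  · exact mul_le_mul_of_nonneg_right ((div_le_iff₀ (hpos x)).2 (hgf x)) (sq_nonneg _)

end Closure

/-! ### The operator F = |m| S |m| and its spectral gap -/

/-- The quantitative data of a solution `m` at a spectral parameter with imaginary part `η`. -/
structure SolutionBounds (μ : Measure X) [IsProbabilityMeasure μ] (S : BB X →ₗ[ℂ] BB X)
    (L : ℕ) (ρ : ℝ) (m : BB X) (η c Λ τ : ℝ) : Prop where
  symm : Symm μ S
  positive : Positive S
  one_le : 1 ≤ L
  rho_pos : 0 < ρ
  le_pow : ∀ u : BB X, (∀ x, 0 ≤ u x) → ∀ x, (ρ : ℂ) * avg μ u ≤ (S ^ L) u x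
  im_pos : ∀ x, 0 < (m x).im
  im_eq : ∀ x, (m x).im = ‖m x‖ ^ 2 * (η + (S (BB.imag m) x).re)
  eta_pos : 0 < η
  c_pos : 0 < c
  c_le : ∀ x, c ≤ ‖m x‖
  norm_le : ‖BB.toL2 μ m‖ ≤ Λ
  le_tau : ∀ x, η + (S (BB.imag m) x).re ≤ τ

namespace SolutionBounds

variable {μ : Measure X} [IsProbabilityMeasure μ] {S : BB X →ₗ[ℂ] BB X} {L : ℕ} {ρ : ℝ}
  {m : BB X} {η c Λ τ : ℝ}

/-- The sine of the argument of `m`. -/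
def sine (m : BB X) : BB X :=
  BB.ofReal (fun x => (m x).im / ‖m x‖)
    ((Complex.measurable_im.comp (BB.meas m)).div (BB.meas m).norm) ⟨1, fun x => by
      rw [abs_div, abs_norm]
      exact div_le_one_of_le₀ (Complex.abs_im_le_norm _) (norm_nonneg _)⟩

theorem sine_apply (m : BB X) (x : X) : sine m x = (((m x).im / ‖m x‖ : ℝ) : ℂ) := rfl

/-- The average of the imaginary part. -/
def dens (μ : Measure X) (m : BB X) : ℝ := ∫ x, (m x).im ∂μ

section

variable (D : SolutionBounds μ S L ρ m η c Λ τ)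
include D

theorem norm_pos (x : X) : 0 < ‖m x‖ := D.c_pos.trans_le (D.c_le x)

theorem eta_le_tau [Nonempty X] : η ≤ τ := by
  obtain ⟨x⟩ := ‹Nonempty X›
  have := D.positive (BB.imag m) (fun y => Complex.zero_le_real.2 (D.im_pos y).le) x
  linarith [D.le_tau x, (Complex.nonneg_iff.1 this).1]

theorem tau_pos [Nonempty X] : 0 < τ := D.eta_pos.trans_le D.eta_le_tau

theorem nonneg_S (x : X) : 0 ≤ (S (BB.imag m) x).re :=
  (Complex.nonneg_iff.1
    (D.positive (BB.imag m) (fun y => Complex.zero_le_real.2 (D.im_pos y).le) x)).1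

theorem im_ge (x : X) : c ^ 2 * η ≤ (m x).im := by
  rw [D.im_eq]
  have h1 := D.nonneg_S x
  have h2 : c ^ 2 ≤ ‖m x‖ ^ 2 := pow_le_pow_left₀ D.c_pos.le (D.c_le x) 2
  have := D.eta_pos
  have : c ^ 2 * η ≤ ‖m x‖ ^ 2 * η := by gcongr
  nlinarith [sq_nonneg ‖m x‖]

theorem sine_le (x : X) : (m x).im / ‖m x‖ ≤ τ * ‖m x‖ := by
  rw [div_le_iff₀ (D.norm_pos x), D.im_eq x]
  nlinarith [D.le_tau x, sq_nonneg ‖m x‖]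

theorem sine_ge : ∃ c' : ℝ, 0 < c' ∧ ∀ x, c' ≤ (m x).im / ‖m x‖ := by
  have := D.eta_pos
  refine ⟨c * η, mul_pos D.c_pos D.eta_pos, fun x => ?_⟩
  rw [le_div_iff₀ (D.norm_pos x), D.im_eq x]
  have h1 : c * ‖m x‖ ≤ ‖m x‖ ^ 2 := by
    rw [sq]; exact mul_le_mul_of_nonneg_right (D.c_le x) (norm_nonneg _)
  have := mul_nonneg (sq_nonneg ‖m x‖) (D.nonneg_S x)
  nlinarith

/-- This is the imaginary part of the equation divided by |m|. It makes the sine a supersolution for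
F, and an exact eigenvector up to an error proportional to η. -/
theorem F_sine (x : X) : sandwich (BB.abs m) S (sine m) x =
    (((m x).im / ‖m x‖ - η * ‖m x‖ : ℝ) : ℂ) := by
  have h : BB.mul (BB.abs m) (sine m) = BB.imag m := BB.ext_apply fun y => by
    rw [BB.mul_apply, sine_apply, BB.abs_apply, BB.imag_apply, ← Complex.ofReal_mul,
      mul_div_cancel₀ _ (D.norm_pos y).ne']
  rw [sandwich_apply, h, D.positive.apply_eq_re (fun y => Complex.ofReal_im _), BB.abs_apply,
    ← Complex.ofReal_mul]
  congr 1
  have := (D.norm_pos x).ne'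
  field_simp
  rw [D.im_eq x]
  ring

theorem F_pos : Positive (sandwich (BB.abs m) S) :=
  D.positive.sandwich fun _ => Complex.zero_le_real.2 (norm_nonneg _)

theorem F_symm : Symm μ (sandwich (BB.abs m) S) :=
  D.symm.sandwich fun _ => Complex.conj_ofReal _

theorem F_pow_sine_le (n : ℕ) (x : X) : (sandwich (BB.abs m) S ^ n) (sine m) x ≤ sine m x := by
  induction n generalizing x with
  | zero => exact le_rfl
  | succ n ih =>
    rw [pow_succ']
    refine (D.F_pos.mono ih x).trans ?_
    rw [D.F_sine, sine_apply, Complex.real_le_real]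
    nlinarith [D.eta_pos, D.norm_pos x]

/-- Of the factors |m| in the product, the first and the last are kept. The n inner pairs |m|² are
bounded below by c². -/
theorem F_pow_ge (n : ℕ) {p : BB X} (hp : ∀ x, 0 ≤ p x) (x : X) :
    ((c ^ (2 * n) : ℝ) : ℂ) * ((‖m x‖ : ℂ) * (S ^ (n + 1)) (BB.mul (BB.abs m) p) x) ≤
      (sandwich (BB.abs m) S ^ (n + 1)) p x := by
  have hq : ∀ y, 0 ≤ BB.mul (BB.abs m) p y := fun y =>
    mul_nonneg (Complex.zero_le_real.2 (norm_nonneg _)) (hp y)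
  induction n generalizing x with
  | zero => simp [sandwich_apply]
  | succ n ih =>
    rw [pow_succ' (sandwich (BB.abs m) S) (n + 1)]
    refine le_trans ?_ (D.F_pos.mono (u := ((c ^ (2 * n) : ℝ) : ℂ) •
      BB.mul (BB.abs m) ((S ^ (n + 1)) (BB.mul (BB.abs m) p))) ih x)
    rw [map_smul, BB.smul_apply, sandwich_apply]
    have h1 : S (((c ^ 2 : ℝ) : ℂ) • (S ^ (n + 1)) (BB.mul (BB.abs m) p)) x ≤
        S (BB.mul (BB.abs m) (BB.mul (BB.abs m) ((S ^ (n + 1)) (BB.mul (BB.abs m) p)))) x := by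
      refine D.positive.mono (fun y => ?_) x
      rw [BB.smul_apply, BB.mul_apply, BB.mul_apply, ← mul_assoc, BB.abs_apply,
        ← Complex.ofReal_mul, ← sq]
      refine mul_le_mul_of_nonneg_right (Complex.real_le_real.2 ?_)
        (D.positive.pow_mono _ hq y)
      exact pow_le_pow_left₀ D.c_pos.le (D.c_le y) 2
    rw [map_smul, BB.smul_apply] at h1
    have h2 : S ((S ^ (n + 1)) (BB.mul (BB.abs m) p)) = (S ^ (n + 1 + 1)) (BB.mul (BB.abs m) p) := by
      rw [pow_succ' _ (n + 1)]; rfl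
    rw [h2] at h1
    have hc : (0 : ℂ) ≤ ((c ^ (2 * n) : ℝ) : ℂ) :=
      Complex.zero_le_real.2 (pow_nonneg D.c_pos.le _)
    have hm : (0 : ℂ) ≤ (‖m x‖ : ℂ) := Complex.zero_le_real.2 (norm_nonneg _)
    have h3 := mul_le_mul_of_nonneg_left (mul_le_mul_of_nonneg_left h1 hm) hc
    refine le_trans (le_of_eq ?_) h3
    push_cast
    ring

theorem F_pow_ge_rankOne {p : BB X} (hp : ∀ x, 0 ≤ p x) (x : X) :
    rankOne μ (c ^ (2 * (L - 1)) * ρ) (BB.abs m) p x ≤ (sandwich (BB.abs m) S ^ L) p x := by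
  have hq : ∀ y, 0 ≤ BB.mul (BB.abs m) p y := fun y =>
    mul_nonneg (Complex.zero_le_real.2 (norm_nonneg _)) (hp y)
  have h1 := D.F_pow_ge (L - 1) hp x
  rw [Nat.sub_add_cancel D.one_le] at h1
  refine le_trans ?_ h1
  have hc : (0 : ℂ) ≤ ((c ^ (2 * (L - 1)) : ℝ) : ℂ) :=
    Complex.zero_le_real.2 (pow_nonneg D.c_pos.le _)
  have hm : (0 : ℂ) ≤ (‖m x‖ : ℂ) := Complex.zero_le_real.2 (norm_nonneg _)
  have h2 := mul_le_mul_of_nonneg_left (mul_le_mul_of_nonneg_left (D.le_pow _ hq x) hm) hc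
  refine le_trans (le_of_eq ?_) h2
  rw [rankOne_apply, BB.inner_toL2, avg]
  simp only [BB.abs_apply, Complex.conj_ofReal, BB.mul_apply]
  push_cast
  ring

theorem inner_abs_sine :
    inner ℂ (BB.toL2 μ (BB.abs m)) (BB.toL2 μ (sine m)) = (dens μ m : ℂ) := by
  rw [BB.inner_toL2, dens, ← integral_complex_ofReal]
  refine integral_congr_ae (Filter.Eventually.of_forall fun x => ?_)
  simp only [BB.abs_apply, Complex.conj_ofReal, sine_apply]
  rw [← Complex.ofReal_mul, mul_div_cancel₀ _ (D.norm_pos x).ne']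

omit D in
theorem norm_abs (m : BB X) : ‖BB.toL2 μ (BB.abs m)‖ = ‖BB.toL2 μ m‖ :=
  le_antisymm (BB.norm_toL2_mono μ (by simp)) (BB.norm_toL2_mono μ (by simp))

theorem dens_pos : 0 < dens μ m := by
  have hc := mul_pos (pow_pos D.c_pos 2) D.eta_pos
  have : ∫ _, c ^ 2 * η ∂μ ≤ dens μ m :=
    integral_mono (integrable_const _) ((BB.integrable μ m).im) fun x => D.im_ge x
  simp only [integral_const, probReal_univ, one_smul] at this
  linarith

/-- The spectral gap. -/
theorem gap [Nonempty X] (w : BB X)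
    (hw : inner ℂ (BB.toL2 μ (BB.abs m)) (BB.toL2 μ w) = 0) :
    c ^ (2 * (L - 1)) * ρ * dens μ m / τ * ‖BB.toL2 μ w‖ ^ 2 ≤
      L * (‖BB.toL2 μ w‖ ^ 2 - ‖BB.toL2 μ (sandwich (BB.abs m) S w)‖ ^ 2) := by
  set δ := c ^ (2 * (L - 1)) * ρ with hδ
  have hδ0 : 0 < δ := mul_pos (pow_pos D.c_pos _) D.rho_pos
  set F := sandwich (BB.abs m) S with hF
  obtain ⟨c', hc', hcf⟩ := D.sine_ge
  have hpos : Positive (F ^ L - rankOne μ δ (BB.abs m)) := fun p hp x => by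
    have := D.F_pow_ge_rankOne hp x
    simpa using this
  have hsymm : Symm μ (F ^ L - rankOne μ δ (BB.abs m)) := (D.F_symm.pow L).sub (rankOne_symm _ _)
  have hreal : ∀ x, (sine m x).im = 0 := fun x => Complex.ofReal_im _
  have hτ := D.tau_pos
  have hv := D.dens_pos
  -- The rank one part maps the sine to δ v |m|, and |m| ≥ sine/τ. So the sine is a supersolution
  -- with factor 1 - δ v/τ for the difference.
  have h1 := hsymm.schur_le hpos (fun x => sine_apply m x) (hpos.apply_eq_re hreal) hc' hcf
    (θ := 1 - δ * dens μ m / τ) (by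
      have : 0 ≤ δ * dens μ m / τ := by positivity
      linarith) (fun x => by
      have h2 := (Complex.le_def.1 (D.F_pow_sine_le L x)).1
      have h3 : ((F ^ L - rankOne μ δ (BB.abs m)) (sine m) x).re =
          ((F ^ L) (sine m) x).re - δ * dens μ m * ‖m x‖ := by
        rw [LinearMap.sub_apply, BB.sub_apply, rankOne_apply, D.inner_abs_sine, BB.abs_apply,
          ← Complex.ofReal_mul, ← Complex.ofReal_mul, Complex.sub_re, Complex.ofReal_re]
      rw [h3]
      rw [sine_apply, Complex.ofReal_re] at h2
      have h4 : δ * dens μ m / τ * ((m x).im / ‖m x‖) ≤ δ * dens μ m / τ * (τ * ‖m x‖) :=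
        mul_le_mul_of_nonneg_left (D.sine_le x) (by positivity)
      have h5 : δ * dens μ m / τ * (τ * ‖m x‖) = δ * dens μ m * ‖m x‖ := by field_simp
      linarith) w
  -- Orthogonality to |m| removes the rank one part, so no exact eigenvector of F is required.
  have h6 : (F ^ L - rankOne μ δ (BB.abs m)) w = (F ^ L) w := BB.ext_apply fun x => by
    rw [LinearMap.sub_apply, BB.sub_apply, rankOne_apply, hw]
    simp
  rw [h6] at h1
  have h7 := D.F_symm.norm_sq_sub_pow_le w L
  linarith

theorem integrable_energy (w : BB X) :
    Integrable (fun x => ‖m x‖ ^ 2 / (m x).im * ‖w x‖ ^ 2) μ := by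
  refine BB.integrable_real μ ?_ ⟨‖m‖ ^ 2 / (c ^ 2 * η) * ‖w‖ ^ 2, fun x => ?_⟩
  · exact (((BB.meas m).norm.pow_const 2).div (Complex.measurable_im.comp (BB.meas m))).mul
      ((BB.meas w).norm.pow_const 2)
  · have := D.im_pos x
    rw [abs_of_nonneg (by positivity)]
    have := mul_pos (pow_pos D.c_pos 2) D.eta_pos
    have h1 := BB.norm_apply_le m x
    have h2 := BB.norm_apply_le w x
    have h3 := D.im_ge x
    gcongr

/-- The basic `L²` bound on `F`. -/
theorem norm_F_sq_le (w : BB X) :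
    ‖BB.toL2 μ (sandwich (BB.abs m) S w)‖ ^ 2 + η * ∫ x, ‖m x‖ ^ 2 / (m x).im * ‖w x‖ ^ 2 ∂μ ≤
      ‖BB.toL2 μ w‖ ^ 2 := by
  obtain ⟨c', hc', hcf⟩ := D.sine_ge
  have h1 := D.F_symm.schur D.F_pos (fun x => sine_apply m x) D.F_sine hc' hcf
    (fun x => by nlinarith [D.eta_pos, D.norm_pos x]) w
  have hi := D.integrable_energy w
  -- The Schur weight is (F s)/s = 1 - η|m|²/Im m. Its deviation from 1 is the energy term.
  have h2 : ∫ x, ((m x).im / ‖m x‖ - η * ‖m x‖) / ((m x).im / ‖m x‖) * ‖w x‖ ^ 2 ∂μ =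
      ‖BB.toL2 μ w‖ ^ 2 - η * ∫ x, ‖m x‖ ^ 2 / (m x).im * ‖w x‖ ^ 2 ∂μ := by
    rw [BB.norm_toL2_sq, ← integral_const_mul,
      ← integral_sub (BB.integrable_norm_sq μ w) (hi.const_mul _)]
    refine integral_congr_ae (Filter.Eventually.of_forall fun x => ?_)
    have h1 := (D.norm_pos x).ne'
    have h2 := (D.im_pos x).ne'
    beta_reduce at h1 h2 ⊢
    field_simp
  linarith

theorem norm_F_le (w : BB X) : ‖BB.toL2 μ (sandwich (BB.abs m) S w)‖ ≤ ‖BB.toL2 μ w‖ := by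
  refine le_of_sq_le_sq ?_ (norm_nonneg _)
  have h := D.norm_F_sq_le w
  have : 0 ≤ ∫ x, ‖m x‖ ^ 2 / (m x).im * ‖w x‖ ^ 2 ∂μ :=
    integral_nonneg fun x => mul_nonneg (div_nonneg (sq_nonneg _) (D.im_pos x).le) (sq_nonneg _)
  nlinarith [D.eta_pos]

end

end SolutionBounds

/-! ### Stability of the linearised equation -/

theorem stability_arith {N N' G t v η τ β Λ : ℝ} (hN : 0 ≤ N) (hG : 0 ≤ G)
    (ht : 0 ≤ t) (hv : 0 < v) (hτ : 0 < τ) (hβ : 0 < β) (hΛ : 0 < Λ)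
    (h1 : N' ^ 2 ≤ β * (N * G / v + t ^ 2 * η))
    (h2 : 2 * t * (v ^ 2 / Λ ^ 2) ≤ t * η * Λ + 2 * N' + G)
    (h3 : N ≤ t * (τ * Λ) + N')
    (h4 : η * Λ ^ 3 ≤ v ^ 2 / 2) (h5 : 16 * Λ ^ 4 * β * η ≤ v ^ 4)
    (h6 : v ≤ τ * Λ ^ 2) (h7 : v ≤ Λ) :
    N ≤ (25 * τ ^ 2 * Λ ^ 6 * β / v ^ 5 + 4 * τ * Λ ^ 3 / v ^ 2) * G := by
  set Y := Real.sqrt (β * (N * G / v)) with hY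
  have hY0 : 0 ≤ Y := Real.sqrt_nonneg _
  have hYsq : Y ^ 2 = β * (N * G / v) := Real.sq_sqrt (by positivity)
  -- The condition 16Λ⁴βη ≤ v⁴ makes the t-part of N' small enough to be absorbed below.
  have h8 : N' ≤ Y + t * (v ^ 2 / (4 * Λ ^ 2)) := by
    refine le_of_sq_le_sq (h1.trans ?_) (by positivity)
    have h9 : β * η ≤ (v ^ 2 / (4 * Λ ^ 2)) ^ 2 := by
      rw [div_pow, le_div_iff₀ (by positivity)]
      nlinarith
    have h10 : t ^ 2 * (β * η) ≤ t ^ 2 * (v ^ 2 / (4 * Λ ^ 2)) ^ 2 := by gcongr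
    have h11 : 0 ≤ Y * (t * (v ^ 2 / (4 * Λ ^ 2))) := by positivity
    nlinarith
  have h9 : t * η * Λ ≤ t * (v ^ 2 / Λ ^ 2) / 2 := by
    have : η * Λ ≤ v ^ 2 / Λ ^ 2 / 2 := by
      rw [div_div, le_div_iff₀ (by positivity)]
      nlinarith
    nlinarith
  have h10 : t * (v ^ 2 / (4 * Λ ^ 2)) = t * (v ^ 2 / Λ ^ 2) / 4 := by ring
  -- Half of the left side of `h2` is used up: a quarter by the t-part of 2N', a quarter by the term
  -- with η.
  have h11 : t * (v ^ 2 / Λ ^ 2) ≤ 2 * Y + G := by linarith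
  set a := τ * Λ ^ 3 / v ^ 2 with ha
  have ha1 : 1 ≤ a := by
    rw [ha, le_div_iff₀ (by positivity)]
    have : v * v ≤ τ * Λ ^ 2 * Λ := by gcongr
    nlinarith
  have h12 : t * (τ * Λ) = a * (t * (v ^ 2 / Λ ^ 2)) := by rw [ha]; field_simp
  have h13 : N ≤ a * (5 * Y + 2 * G) := by
    rw [h12] at h3
    have h14 : a * (t * (v ^ 2 / Λ ^ 2)) ≤ a * (2 * Y + G) := by gcongr
    have h15 : 1 * (Y + t * (v ^ 2 / (4 * Λ ^ 2))) ≤ a * (Y + t * (v ^ 2 / (4 * Λ ^ 2))) := by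
      gcongr
    have h16 : a * (t * (v ^ 2 / (4 * Λ ^ 2))) ≤ a * ((2 * Y + G) / 4) := by
      rw [h10]; gcongr
    have h17 : 0 ≤ a * Y := by positivity
    have h18 : 0 ≤ a * G := by positivity
    nlinarith
  have h14 : (25 * τ ^ 2 * Λ ^ 6 * β / v ^ 5 + 4 * τ * Λ ^ 3 / v ^ 2) * G =
      25 * a ^ 2 * (β * G / v) + 4 * a * G := by
    rw [ha]; field_simp
  rw [h14]
  have h15 : Y ^ 2 = N * (β * G / v) := by rw [hYsq]; ring
  set P := β * G / v
  have hP : 0 ≤ P := by positivity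
  -- Since Y² is N times P = βG/v, Young's inequality absorbs half of N from 5aY. This produces the
  -- constants 25 and 4.
  by_contra! hcon
  have h16 : 5 * a * Y ≤ N / 2 + 25 * a ^ 2 * P / 2 := by
    refine le_of_sq_le_sq ?_ (by positivity)
    have : (5 * a * Y) ^ 2 = 25 * a ^ 2 * (N * P) := by rw [mul_pow, h15]; ring
    rw [this]
    nlinarith [sq_nonneg (N / 2 - 25 * a ^ 2 * P / 2)]
  linarith

namespace SolutionBounds

variable {μ : Measure X} [IsProbabilityMeasure μ] {S : BB X →ₗ[ℂ] BB X} {L : ℕ} {ρ : ℝ}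
  {m : BB X} {η c Λ τ : ℝ}

section

variable (D : SolutionBounds μ S L ρ m η c Λ τ)
include D

theorem norm_phase (x : X) : ‖(starRingEnd ℂ) (m x) / m x‖ = 1 := by
  rw [norm_div, Complex.norm_conj, div_self (D.norm_pos x).ne']

theorem ne_zero (x : X) : m x ≠ 0 := by
  have := D.norm_pos x
  exact norm_pos_iff.1 this

theorem norm_phase_sub_one (x : X) :
    ‖(starRingEnd ℂ) (m x) / m x - 1‖ = 2 * ((m x).im / ‖m x‖) := by
  have h0 := D.ne_zero x
  have h1 : (starRingEnd ℂ) (m x) / m x - 1 = -(2 * (m x).im * Complex.I) / m x := by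
    have h2 : (starRingEnd ℂ) (m x) - m x = -(2 * (m x).im * Complex.I) := by
      apply Complex.ext
      · simp
      · simp; ring
    rw [← h2]
    field_simp
  rw [h1, norm_div, norm_neg, norm_mul, norm_mul, Complex.norm_I, Complex.norm_real,
    Real.norm_eq_abs, abs_of_pos (D.im_pos x), Complex.norm_ofNat]
  ring

variable {w g : BB X}
  (hw : ∀ x, (starRingEnd ℂ) (m x) / m x * w x = sandwich (BB.abs m) S w x + g x)

include hw in
-- The phase m̄/m is unimodular, so ‖w‖ ≤ ‖F w‖ + ‖g‖; combine this with ‖F w‖ ≤ ‖w‖.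
theorem norm_sq_sub_le :
    ‖BB.toL2 μ w‖ ^ 2 - ‖BB.toL2 μ (sandwich (BB.abs m) S w)‖ ^ 2 ≤
      2 * ‖BB.toL2 μ w‖ * ‖BB.toL2 μ g‖ := by
  have h1 : ‖BB.toL2 μ w‖ ≤ ‖BB.toL2 μ (sandwich (BB.abs m) S w)‖ + ‖BB.toL2 μ g‖ := by
    refine le_trans ?_ (norm_add_le _ _)
    rw [← BB.toL2_add]
    refine BB.norm_toL2_mono μ fun x => ?_
    rw [BB.add_apply, ← hw, norm_mul, D.norm_phase, one_mul]
  have h2 := D.norm_F_le w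
  have := norm_nonneg (BB.toL2 μ g)
  nlinarith [norm_nonneg (BB.toL2 μ w), norm_nonneg (BB.toL2 μ (sandwich (BB.abs m) S w))]

include hw in
theorem energy_le :
    η * ∫ x, ‖m x‖ ^ 2 / (m x).im * ‖w x‖ ^ 2 ∂μ ≤ 2 * ‖BB.toL2 μ w‖ * ‖BB.toL2 μ g‖ := by
  have h1 := D.norm_F_sq_le w
  have h2 := D.norm_sq_sub_le hw
  linarith

include hw in
/-- The stability estimate close to the real line, away from small spectral parameters. -/
theorem norm_le_of_eta [Nonempty X] :
    ‖BB.toL2 μ w‖ ≤ 2 * τ / η * ‖BB.toL2 μ g‖ := by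
  have h1 := D.energy_le hw
  have hτ := D.tau_pos
  have hη := D.eta_pos
  -- By the imaginary part of the equation the weight is 1/(η + S Im m), which is at least 1/τ.
  have h2 : ‖BB.toL2 μ w‖ ^ 2 / τ ≤ ∫ x, ‖m x‖ ^ 2 / (m x).im * ‖w x‖ ^ 2 ∂μ := by
    rw [BB.norm_toL2_sq, div_eq_inv_mul, ← integral_const_mul]
    refine integral_mono ((BB.integrable_norm_sq μ w).const_mul _) (D.integrable_energy w)
      fun x => ?_
    refine mul_le_mul_of_nonneg_right ?_ (sq_nonneg _)
    rw [inv_eq_one_div, div_le_div_iff₀ hτ (D.im_pos x), D.im_eq x]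
    nlinarith [D.le_tau x, sq_nonneg ‖m x‖]
  by_cases h0 : ‖BB.toL2 μ w‖ = 0
  · rw [h0]; positivity
  have h3 : 0 < ‖BB.toL2 μ w‖ := lt_of_le_of_ne (norm_nonneg _) (Ne.symm h0)
  have h4 : η * (‖BB.toL2 μ w‖ ^ 2 / τ) ≤ 2 * ‖BB.toL2 μ w‖ * ‖BB.toL2 μ g‖ :=
    le_trans (by gcongr) h1
  have h5 : ‖BB.toL2 μ w‖ * (η * ‖BB.toL2 μ w‖) ≤
      ‖BB.toL2 μ w‖ * (2 * τ * ‖BB.toL2 μ g‖) := by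
    rw [← mul_div_assoc, div_le_iff₀ hτ] at h4
    linarith
  have h6 := le_of_mul_le_mul_left h5 h3
  rw [div_mul_eq_mul_div, le_div_iff₀ hη]
  linarith

/-- Cauchy-Schwarz with |m| written as √(Im m) times |m|/√(Im m): the first factor contributes v,
the second the energy. -/
theorem norm_inner_sq_le (w : BB X) :
    ‖inner ℂ (BB.toL2 μ (BB.abs m)) (BB.toL2 μ w)‖ ^ 2 ≤
      dens μ m * ∫ x, ‖m x‖ ^ 2 / (m x).im * ‖w x‖ ^ 2 ∂μ := by
  have hmim : Measurable fun x => (m x).im := Complex.measurable_im.comp (BB.meas m)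
  set p : BB X := BB.ofReal (fun x => Real.sqrt (m x).im) hmim.sqrt
    ⟨Real.sqrt ‖m‖, fun x => by
      rw [abs_of_nonneg (Real.sqrt_nonneg _)]
      exact Real.sqrt_le_sqrt ((le_abs_self _).trans
        ((Complex.abs_im_le_norm _).trans (BB.norm_apply_le m x)))⟩ with hp
  have hc := mul_pos (pow_pos D.c_pos 2) D.eta_pos
  set q : BB X := BB.ofReal (fun x => ‖m x‖ / Real.sqrt (m x).im)
    ((BB.meas m).norm.div hmim.sqrt)
    ⟨‖m‖ / Real.sqrt (c ^ 2 * η), fun x => by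
      rw [abs_of_nonneg (by positivity)]
      exact div_le_div₀ (norm_nonneg _) (BB.norm_apply_le m x) (Real.sqrt_pos.2 hc)
        (Real.sqrt_le_sqrt (D.im_ge x))⟩ with hq
  have h1 := BB.norm_integral_mul_le μ p (BB.mul q w)
  have h2 : inner ℂ (BB.toL2 μ (BB.abs m)) (BB.toL2 μ w) = ∫ x, p x * BB.mul q w x ∂μ := by
    rw [BB.inner_toL2]
    refine integral_congr_ae (Filter.Eventually.of_forall fun x => ?_)
    have : Real.sqrt (m x).im ≠ 0 := (Real.sqrt_pos.2 (D.im_pos x)).ne'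
    simp only [BB.abs_apply, Complex.conj_ofReal, BB.mul_apply, hp, hq, BB.ofReal_apply]
    rw [← mul_assoc, ← Complex.ofReal_mul, mul_div_cancel₀ _ this]
  have h3 : ‖BB.toL2 μ p‖ ^ 2 = dens μ m := by
    rw [BB.norm_toL2_sq, dens]
    refine integral_congr_ae (Filter.Eventually.of_forall fun x => ?_)
    simp only [hp, BB.ofReal_apply, Complex.norm_real, Real.norm_eq_abs, sq_abs]
    exact Real.sq_sqrt (D.im_pos x).le
  have h4 : ‖BB.toL2 μ (BB.mul q w)‖ ^ 2 = ∫ x, ‖m x‖ ^ 2 / (m x).im * ‖w x‖ ^ 2 ∂μ := by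
    rw [BB.norm_toL2_sq]
    refine integral_congr_ae (Filter.Eventually.of_forall fun x => ?_)
    simp only [BB.mul_apply, norm_mul, hq, BB.ofReal_apply, Complex.norm_real, Real.norm_eq_abs,
      mul_pow, sq_abs, div_pow]
    rw [Real.sq_sqrt (D.im_pos x).le]
  rw [h2, ← h3, ← h4, ← mul_pow]
  exact pow_le_pow_left₀ (norm_nonneg _) h1 2

include hw in
-- This pairing with |m| becomes the difference of the averages. The factor √v, absent from the
-- bound on ‖w‖, is what part (i) exploits.
theorem norm_inner_sq_le_of_eta [Nonempty X] :
    ‖inner ℂ (BB.toL2 μ (BB.abs m)) (BB.toL2 μ w)‖ ^ 2 ≤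
      4 * τ * dens μ m / η ^ 2 * ‖BB.toL2 μ g‖ ^ 2 := by
  have h1 := D.norm_inner_sq_le w
  have h2 := D.energy_le hw
  have h3 := D.norm_le_of_eta hw
  have hη := D.eta_pos
  have hv := D.dens_pos
  refine h1.trans ?_
  have h4 : η * ∫ x, ‖m x‖ ^ 2 / (m x).im * ‖w x‖ ^ 2 ∂μ ≤
      2 * (2 * τ / η * ‖BB.toL2 μ g‖) * ‖BB.toL2 μ g‖ := h2.trans (by gcongr)
  rw [← le_div_iff₀' hη] at h4
  refine (mul_le_mul_of_nonneg_left h4 hv.le).trans (le_of_eq ?_)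
  field_simp
  ring

theorem dens_le : dens μ m ≤ ‖BB.toL2 μ m‖ * ‖BB.toL2 μ (sine m)‖ := by
  have h := norm_inner_le_norm (𝕜 := ℂ) (BB.toL2 μ (BB.abs m)) (BB.toL2 μ (sine m))
  rwa [D.inner_abs_sine, norm_abs, Complex.norm_real, Real.norm_eq_abs,
    abs_of_pos D.dens_pos] at h

theorem Lam_pos : 0 < Λ := by
  refine lt_of_lt_of_le ?_ D.norm_le
  by_contra! h
  have h1 := D.dens_le
  have h2 := D.dens_pos
  have : ‖BB.toL2 μ m‖ = 0 := le_antisymm h (norm_nonneg _)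
  rw [this] at h1
  linarith

theorem norm_sine_le [Nonempty X] : ‖BB.toL2 μ (sine m)‖ ≤ τ * Λ := by
  have h1 : ‖BB.toL2 μ (sine m)‖ ≤ τ * ‖BB.toL2 μ m‖ :=
    BB.norm_toL2_le μ D.tau_pos.le fun x => by
      rw [sine_apply, Complex.norm_real, Real.norm_eq_abs,
        abs_of_pos (div_pos (D.im_pos x) (D.norm_pos x))]
      exact D.sine_le x
  exact h1.trans (mul_le_mul_of_nonneg_left D.norm_le D.tau_pos.le)

theorem dens_le_tau [Nonempty X] : dens μ m ≤ τ * Λ ^ 2 := by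
  refine D.dens_le.trans ((mul_le_mul D.norm_le D.norm_sine_le (norm_nonneg _)
    D.Lam_pos.le).trans (le_of_eq (by ring)))

theorem dens_le_Lam : dens μ m ≤ Λ := by
  have h : ‖BB.toL2 μ (sine m)‖ ≤ 1 := ?_
  · exact D.dens_le.trans ((mul_le_mul D.norm_le h (norm_nonneg _)
      D.Lam_pos.le).trans (mul_one Λ).le)
  refine (BB.norm_toL2_le_norm μ _).trans (BB.norm_le zero_le_one fun x => ?_)
  rw [sine_apply, Complex.norm_real, Real.norm_eq_abs,
    abs_of_pos (div_pos (D.im_pos x) (D.norm_pos x))]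
  exact div_le_one_of_le₀ ((le_abs_self _).trans (Complex.abs_im_le_norm _)) (norm_nonneg _)

/-- Cauchy-Schwarz twice: v ≤ Λ‖s‖₂, and ‖s‖₂² = ⟨s²⟩ ≤ ‖s²‖₂. It quantifies how far the phase m̄/m
moves s. -/
theorem dens_sq_le : dens μ m ^ 2 / Λ ^ 2 ≤ ‖BB.toL2 μ (BB.mul (sine m) (sine m))‖ := by
  have h1 : dens μ m ≤ Λ * ‖BB.toL2 μ (sine m)‖ :=
    D.dens_le.trans (mul_le_mul_of_nonneg_right D.norm_le (norm_nonneg _))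
  have hΛ := D.Lam_pos
  have h2 : dens μ m ^ 2 / Λ ^ 2 ≤ ‖BB.toL2 μ (sine m)‖ ^ 2 := by
    rw [div_le_iff₀ (by positivity), ← mul_pow, mul_comm]
    exact pow_le_pow_left₀ D.dens_pos.le h1 2
  refine h2.trans ?_
  have h3 := BB.norm_integral_mul_le μ (BB.const 1) (BB.mul (sine m) (sine m))
  have h4 : ‖BB.toL2 μ (BB.const 1 : BB X)‖ ≤ 1 :=
    (BB.norm_toL2_le_norm μ _).trans (BB.norm_le zero_le_one fun x => by simp)
  have h5 : ∫ x, (BB.const 1 : BB X) x * BB.mul (sine m) (sine m) x ∂μ =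
      ((‖BB.toL2 μ (sine m)‖ ^ 2 : ℝ) : ℂ) := by
    rw [BB.norm_toL2_sq, ← integral_complex_ofReal]
    refine integral_congr_ae (Filter.Eventually.of_forall fun x => ?_)
    simp only [BB.const_apply, one_mul, BB.mul_apply, sine_apply, Complex.norm_real,
      Real.norm_eq_abs, sq_abs]
    push_cast
    ring
  rw [h5, Complex.norm_real, Real.norm_eq_abs, abs_of_nonneg (sq_nonneg _)] at h3
  exact h3.trans (mul_le_of_le_one_left (norm_nonneg _) h4)

theorem defect_sine :
    ‖BB.toL2 μ (sine m)‖ ^ 2 - ‖BB.toL2 μ (sandwich (BB.abs m) S (sine m))‖ ^ 2 ≤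
      2 * η * dens μ m := by
  have h1 : sandwich (BB.abs m) S (sine m) = sine m - (η : ℂ) • BB.abs m :=
    BB.ext_apply fun x => by
      rw [D.F_sine, BB.sub_apply, BB.smul_apply, sine_apply, BB.abs_apply]
      push_cast
      rfl
  have h2 := norm_sub_sq (𝕜 := ℂ) (BB.toL2 μ (sine m)) (BB.toL2 μ ((η : ℂ) • BB.abs m))
  rw [BB.toL2_smul, inner_smul_right, ← inner_conj_symm, D.inner_abs_sine, Complex.conj_ofReal,
    ← Complex.ofReal_mul] at h2
  have h3 : RCLike.re ((η * dens μ m : ℝ) : ℂ) = η * dens μ m := Complex.ofReal_re _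
  rw [h3] at h2
  rw [h1, BB.toL2_sub, BB.toL2_smul, h2]
  nlinarith [sq_nonneg ‖(η : ℂ) • BB.toL2 μ (BB.abs m)‖]

/-- The quadratic form ‖u‖² - ‖F u‖² is non-negative, so the parallelogram law bounds it on a
difference. -/
theorem defect_sub_le (u w : BB X) :
    ‖BB.toL2 μ (w - u)‖ ^ 2 - ‖BB.toL2 μ (sandwich (BB.abs m) S (w - u))‖ ^ 2 ≤
      2 * (‖BB.toL2 μ w‖ ^ 2 - ‖BB.toL2 μ (sandwich (BB.abs m) S w)‖ ^ 2) +
      2 * (‖BB.toL2 μ u‖ ^ 2 - ‖BB.toL2 μ (sandwich (BB.abs m) S u)‖ ^ 2) := by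
  have h1 := parallelogram_law_with_norm ℂ (BB.toL2 μ w) (BB.toL2 μ u)
  have h2 := parallelogram_law_with_norm ℂ (BB.toL2 μ (sandwich (BB.abs m) S w))
    (BB.toL2 μ (sandwich (BB.abs m) S u))
  rw [← BB.toL2_sub, ← BB.toL2_add, ← map_sub, ← map_add] at h2
  rw [← BB.toL2_sub, ← BB.toL2_add] at h1
  have h3 := D.norm_F_le (w + u)
  nlinarith [norm_nonneg (BB.toL2 μ (sandwich (BB.abs m) S (w + u)))]

include hw in
/-- The stability estimate in terms of the density. -/
theorem norm_le_of_dens [Nonempty X] (h4 : η * Λ ^ 3 ≤ dens μ m ^ 2 / 2)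
    (h5 : 16 * Λ ^ 4 * (4 * L * τ / (c ^ (2 * (L - 1)) * ρ)) * η ≤ dens μ m ^ 4) :
    ‖BB.toL2 μ w‖ ≤ (25 * τ ^ 2 * Λ ^ 6 * (4 * L * τ / (c ^ (2 * (L - 1)) * ρ)) / dens μ m ^ 5 +
      4 * τ * Λ ^ 3 / dens μ m ^ 2) * ‖BB.toL2 μ g‖ := by
  have hv := D.dens_pos
  have hη := D.eta_pos
  have hτ := D.tau_pos
  have hΛ := D.Lam_pos
  have hL : (0 : ℝ) < L := by exact_mod_cast D.one_le
  set δ := c ^ (2 * (L - 1)) * ρ with hδ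
  have hδ0 : 0 < δ := mul_pos (pow_pos D.c_pos _) D.rho_pos
  set v := dens μ m with hv'
  set F := sandwich (BB.abs m) S with hF
  -- Since ⟨|m|, s⟩ = v, this coefficient makes w' = w - t s orthogonal to |m|.
  set t : ℂ := inner ℂ (BB.toL2 μ (BB.abs m)) (BB.toL2 μ w) / (v : ℂ) with ht
  set w' : BB X := w - t • sine m with hw'
  have hvc : (v : ℂ) ≠ 0 := by exact_mod_cast hv.ne'
  have horth : inner ℂ (BB.toL2 μ (BB.abs m)) (BB.toL2 μ w') = 0 := by
    rw [hw', BB.toL2_sub, BB.toL2_smul, inner_sub_right, inner_smul_right, D.inner_abs_sine, ht,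
      div_mul_cancel₀ _ hvc, sub_self]
  have hgap := D.gap w' horth
  have hdef := D.defect_sub_le (t • sine m) w
  have hdw := D.norm_sq_sub_le hw
  have hds := D.defect_sine
  rw [← hw', ← hF, map_smul, BB.toL2_smul, BB.toL2_smul, norm_smul, norm_smul] at hdef
  have hw'def : ‖BB.toL2 μ w'‖ ^ 2 - ‖BB.toL2 μ (F w')‖ ^ 2 ≤
      4 * (‖BB.toL2 μ w‖ * ‖BB.toL2 μ g‖) + 4 * (‖t‖ ^ 2 * η * v) := by
    have : ‖t‖ ^ 2 * (‖BB.toL2 μ (sine m)‖ ^ 2 - ‖BB.toL2 μ (F (sine m))‖ ^ 2) ≤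
        ‖t‖ ^ 2 * (2 * η * v) := by gcongr
    nlinarith
  refine stability_arith (N' := ‖BB.toL2 μ w'‖) (t := ‖t‖) (norm_nonneg _) (norm_nonneg _)
    (norm_nonneg _) hv hτ (by positivity) hΛ ?_ ?_ ?_ h4 h5 D.dens_le_tau
    D.dens_le_Lam
  · have h6 : δ * v / τ * ‖BB.toL2 μ w'‖ ^ 2 ≤
        L * (4 * (‖BB.toL2 μ w‖ * ‖BB.toL2 μ g‖) + 4 * (‖t‖ ^ 2 * η * v)) :=
      hgap.trans (by gcongr)
    have h7 : 0 < δ * v / τ := by positivity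
    rw [← le_div_iff₀' h7] at h6
    refine h6.trans (le_of_eq ?_)
    field_simp
  · set U : BB X := BB.mk (fun x => (starRingEnd ℂ) (m x) / m x)
      ((Complex.continuous_conj.measurable.comp (BB.meas m)).div (BB.meas m))
      ⟨1, fun x => (D.norm_phase x).le⟩ with hU
    -- Inserting w = t s + w' and F s = s - η|m| into the equation gives e = t (m̄/m - 1) s, whose
    -- modulus is 2|t|s². Hence t is bounded through w', g and η.
    set e : BB X := F w' + g - BB.mul U w' - (t * η) • BB.abs m with he
    have he1 : ∀ x, e x = t * (((starRingEnd ℂ) (m x) / m x - 1) * sine m x) := fun x => by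
      have h8 : F w' x = F w x - t * F (sine m) x := by
        rw [hw', map_sub, map_smul]; rfl
      have h9 := hw x
      have h10 := D.F_sine x
      rw [← hF] at h10
      have h11 : w' x = w x - t * sine m x := rfl
      simp only [he, BB.sub_apply, BB.add_apply, BB.mul_apply, BB.smul_apply, h8, h11, h10, hU,
        BB.mk_apply, BB.abs_apply]
      have h15 := sine_apply m x
      push_cast at h15 ⊢
      linear_combination -h9 + t * h15
    have he2 : ∀ x, ‖e x‖ = 2 * ‖t‖ * ‖BB.mul (sine m) (sine m) x‖ := fun x => by
      rw [he1, norm_mul, norm_mul, D.norm_phase_sub_one, BB.mul_apply, norm_mul, sine_apply,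
        Complex.norm_real, Real.norm_eq_abs, abs_of_pos (div_pos (D.im_pos x) (D.norm_pos x))]
      ring
    have he3 : 2 * ‖t‖ * ‖BB.toL2 μ (BB.mul (sine m) (sine m))‖ ≤ ‖BB.toL2 μ e‖ := by
      have := BB.norm_toL2_le μ (u := (2 * t) • BB.mul (sine m) (sine m)) (w := e) zero_le_one
        (fun x => by
          rw [one_mul, he2, BB.smul_apply, norm_mul, norm_mul, Complex.norm_ofNat])
      rw [BB.toL2_smul, norm_smul, norm_mul, Complex.norm_ofNat, one_mul] at this
      exact this
    have he4 : ‖BB.toL2 μ e‖ ≤ ‖BB.toL2 μ w'‖ + ‖BB.toL2 μ g‖ + ‖BB.toL2 μ w'‖ +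
        ‖t‖ * η * Λ := by
      rw [he, BB.toL2_sub, BB.toL2_sub, BB.toL2_add, BB.toL2_smul]
      refine (norm_sub_le _ _).trans (add_le_add ((norm_sub_le _ _).trans (add_le_add
        ((norm_add_le _ _).trans (add_le_add_left (D.norm_F_le w') _)) ?_)) ?_)
      · refine BB.norm_toL2_mono μ fun x => ?_
        rw [BB.mul_apply, norm_mul, hU, BB.mk_apply, D.norm_phase, one_mul]
      · rw [norm_smul, norm_mul, Complex.norm_real, Real.norm_eq_abs, abs_of_pos hη, norm_abs]
        exact mul_le_mul_of_nonneg_left D.norm_le (by positivity)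
    have h12 := mul_le_mul_of_nonneg_left D.dens_sq_le (by positivity : 0 ≤ 2 * ‖t‖)
    linarith
  · have h13 : w = t • sine m + w' := by rw [hw']; abel
    have h14 : ‖BB.toL2 μ w‖ ≤ ‖t‖ * ‖BB.toL2 μ (sine m)‖ + ‖BB.toL2 μ w'‖ := by
      conv_lhs => rw [h13]
      rw [BB.toL2_add, BB.toL2_smul]
      exact (norm_add_le _ _).trans (by rw [norm_smul])
    exact h14.trans (by gcongr; exact D.norm_sine_le)

end

end SolutionBounds

/-! ### Continuity of the solution inside the half plane -/

theorem SymmetricPositive.positive {μ : Measure X} {S : BB X →L[ℂ] BB X}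
    (hS : SymmetricPositive μ S) : Positive (S : BB X →ₗ[ℂ] BB X) := hS.pos

theorem sqrt_mul_le_add {p r s : ℝ} (hp : 0 ≤ p) (hr : 0 ≤ r) (hs : 0 < s) :
    Real.sqrt (p * r) ≤ (s * p + r / s) / 2 := by
  refine Real.sqrt_le_iff.2 ⟨by positivity, ?_⟩
  have h4 : p * r = (s * p) * (r / s) := by field_simp
  rw [h4]
  nlinarith [sq_nonneg (s * p - r / s)]

/-- A Cauchy-Schwarz inequality for geometric means. The mean √(Im u Im v) lies below a weighted
arithmetic mean, to which the linear operator applies, and the weight s = B/A is optimal at x. -/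
theorem Positive.norm_le_of_weight {G : BB X →ₗ[ℂ] BB X} (hG : Positive G) {Δ u v : BB X}
    {d lam A B : ℝ} {x : X} (hd : 0 ≤ d) (hA : 0 < A) (hB : 0 < B) (hu : ∀ y, 0 ≤ (u y).im)
    (hv : ∀ y, 0 ≤ (v y).im) (hΔ : ∀ y, ‖Δ y‖ ≤ d * Real.sqrt ((u y).im * (v y).im))
    (h4 : (G (BB.imag u) x).re ≤ lam * A ^ 2) (h5 : (G (BB.imag v) x).re ≤ lam * B ^ 2) :
    ‖G Δ x‖ ≤ d * lam * (A * B) := by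
  have hs0 : 0 < B / A := by positivity
  set s := B / A with hs
  have h1 := hG.norm_le_abs Δ x
  have h2 := hG.mono (u := BB.abs Δ)
    (w := ((d / 2 * s : ℝ) : ℂ) • BB.imag u + ((d / 2 / s : ℝ) : ℂ) • BB.imag v)
    (fun y => by
      rw [BB.add_apply, BB.smul_apply, BB.smul_apply, BB.imag_apply, BB.imag_apply,
        BB.abs_apply, ← Complex.ofReal_mul, ← Complex.ofReal_mul, ← Complex.ofReal_add,
        Complex.real_le_real]
      refine (hΔ y).trans ((mul_le_mul_of_nonneg_left
        (sqrt_mul_le_add (hu y) (hv y) hs0) hd).trans (le_of_eq ?_))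
      field_simp) x
  rw [map_add, map_smul, map_smul, BB.add_apply, BB.smul_apply, BB.smul_apply] at h2
  have h3 := (Complex.le_def.1 h2).1
  rw [Complex.add_re, Complex.re_ofReal_mul, Complex.re_ofReal_mul] at h3
  have h6 := mul_le_mul_of_nonneg_left h4 (by positivity : 0 ≤ d / 2 * s)
  have h7 := mul_le_mul_of_nonneg_left h5 (by positivity : 0 ≤ d / 2 / s)
  have h8 : d / 2 * s * (lam * A ^ 2) + d / 2 / s * (lam * B ^ 2) = d * lam * (A * B) := by
    rw [hs]; field_simp; ring
  linarith

theorem map_sub_apply (S : BB X →L[ℂ] BB X) (u w : BB X) (x : X) :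
    S (u - w) x = S u x - S w x := by
  rw [← ContinuousLinearMap.coe_coe S, map_sub]; rfl

theorem norm_apply_le_opNorm (S : BB X →L[ℂ] BB X) (u : BB X) (x : X) : ‖S u x‖ ≤ ‖S‖ * ‖u‖ :=
  (BB.norm_apply_le _ x).trans (S.le_opNorm _)

namespace IsSolution

variable {μ : Measure X} {a : BB X} {S : BB X →L[ℂ] BB X} {m : ℂ → BB X}

section

variable (H : IsSolution a S m)
include H

theorem ne_zero {z : ℂ} (hz : 0 < z.im) (x : X) : m z x ≠ 0 := fun h => by
  have := H.im_pos z hz x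
  rw [h] at this
  simp at this

theorem mul_eq {z : ℂ} (hz : 0 < z.im) (x : X) : m z x * (z + a x + S (m z) x) = -1 := by
  have h := H.ne_zero hz x
  rw [← H.eqn z hz x]
  field_simp

/-- The difference of the equations at two spectral parameters. -/
theorem sub_eq {z w : ℂ} (hz : 0 < z.im) (hw : 0 < w.im) (x : X) :
    (m z - m w) x = m z x * m w x * (z - w + S (m z - m w) x) := by
  have h1 := H.mul_eq hz x
  have h2 := H.mul_eq hw x
  rw [map_sub_apply, BB.sub_apply]
  linear_combination -(m w x) * h1 + m z x * h2

theorem inv_norm_le {z : ℂ} (hz : 0 < z.im) {b : ℝ} (hb : ∀ x, ‖S (m z) x‖ ≤ b) (x : X) :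
    1 ≤ ‖m z x‖ * (‖z‖ + ‖a‖ + b) := by
  have h1 := congrArg norm (H.mul_eq hz x)
  rw [norm_mul, norm_neg, norm_one] at h1
  rw [← h1]
  refine mul_le_mul_of_nonneg_left ?_ (norm_nonneg _)
  exact (norm_add_le _ _).trans (add_le_add ((norm_add_le _ _).trans
    (add_le_add_right (BB.norm_apply_le a x) _)) (hb x))

variable (ha : ∀ x, (a x).im = 0) (hS : SymmetricPositive μ S)
include ha hS

theorem im_eq {z : ℂ} (hz : 0 < z.im) (x : X) :
    (m z x).im = ‖m z x‖ ^ 2 * (z.im + (S (BB.imag (m z)) x).re) := by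
  have h1 := congrArg Complex.im (H.eqn z hz x)
  have h2 := hS.positive.map_imag (m z) x
  rw [ContinuousLinearMap.coe_coe] at h2
  rw [h2, Complex.ofReal_re]
  rw [one_div, Complex.neg_im, Complex.inv_im, Complex.add_im, Complex.add_im, ha] at h1
  have h3 : Complex.normSq (m z x) ≠ 0 := by simpa using H.ne_zero hz x
  rw [neg_div, neg_neg, add_zero, div_eq_iff h3] at h1
  rw [h1, Complex.normSq_eq_norm_sq]
  ring

omit H ha in
theorem nonneg_S {u : BB X} (hu : ∀ x, 0 ≤ (u x).im) (x : X) : 0 ≤ (S (BB.imag u) x).re :=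
  (Complex.nonneg_iff.1
    (hS.positive (BB.imag u) (fun y => Complex.zero_le_real.2 (hu y)) x)).1

theorem norm_apply_le {z : ℂ} (hz : 0 < z.im) (x : X) : ‖m z x‖ ≤ 1 / z.im := by
  have h1 := H.im_eq ha hS hz x
  have h2 := nonneg_S hS (fun y => (H.im_pos z hz y).le) x
  have h3 : 0 < ‖m z x‖ := norm_pos_iff.2 (H.ne_zero hz x)
  have h4 := (le_abs_self _).trans (Complex.abs_im_le_norm (m z x))
  rw [le_div_iff₀ hz]
  have h5 : ‖m z x‖ * (‖m z x‖ * z.im) ≤ ‖m z x‖ * 1 := by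
    nlinarith [mul_nonneg (sq_nonneg ‖m z x‖) h2]
  exact le_of_mul_le_mul_left h5 h3

theorem norm_le {z : ℂ} (hz : 0 < z.im) : ‖m z‖ ≤ 1 / z.im :=
  BB.norm_le (by positivity) fun x => H.norm_apply_le ha hS hz x

theorem S_imag_le {z : ℂ} (hz : 0 < z.im) (x : X) :
    (S (BB.imag (m z)) x).re ≤ ‖S‖ / z.im := by
  have h1 : ‖BB.imag (m z)‖ ≤ 1 / z.im := BB.norm_le (by positivity) fun y => by
    rw [BB.imag_apply, Complex.norm_real, Real.norm_eq_abs]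
    exact (Complex.abs_im_le_norm _).trans (H.norm_apply_le ha hS hz y)
  refine (Complex.re_le_norm _).trans ((norm_apply_le_opNorm S _ x).trans ?_)
  rw [div_eq_mul_one_div]
  exact mul_le_mul_of_nonneg_left h1 S.opNorm_nonneg

/-- With σ = ‖S‖/η, the function t/(η + t) increases and S Im m ≤ σ. The factor σ/(η + σ) < 1 is the
contraction rate. -/
theorem S_imag_le_mul {z : ℂ} {η : ℝ} (hη : 0 < η) (hz : η ≤ z.im) (x : X) :
    (S (BB.imag (m z)) x).re ≤
      ‖S‖ / η / (η + ‖S‖ / η) * (z.im + (S (BB.imag (m z)) x).re) := by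
  have hS0 : 0 ≤ ‖S‖ / η := div_nonneg S.opNorm_nonneg hη.le
  have h1 : (S (BB.imag (m z)) x).re ≤ ‖S‖ / η :=
    (H.S_imag_le ha hS (hη.trans_le hz) x).trans
      (div_le_div_of_nonneg_left S.opNorm_nonneg hη hz)
  generalize ‖S‖ / η = σ at *
  rw [div_mul_eq_mul_div, le_div_iff₀ (by positivity)]
  nlinarith

theorem sqrt_im_mul {z w : ℂ} (hz : 0 < z.im) (hw : 0 < w.im) (x : X) :
    Real.sqrt ((m z x).im * (m w x).im) = ‖m z x‖ * ‖m w x‖ *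
      (Real.sqrt (z.im + (S (BB.imag (m z)) x).re) *
        Real.sqrt (w.im + (S (BB.imag (m w)) x).re)) := by
  have h1 := nonneg_S hS (fun y => (H.im_pos z hz y).le) x
  rw [H.im_eq ha hS hz, H.im_eq ha hS hw,
    Real.sqrt_mul (by positivity), Real.sqrt_mul (by positivity), Real.sqrt_mul (by positivity),
    Real.sqrt_sq (norm_nonneg _), Real.sqrt_sq (norm_nonneg _)]
  ring

omit H ha in
theorem le_sqrt_mul_sqrt {z w : ℂ} {η : ℝ} (hη : 0 < η) (hz : η ≤ z.im) (hw : η ≤ w.im)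
    {u v : BB X} (hu : ∀ x, 0 ≤ (u x).im) (hv : ∀ x, 0 ≤ (v x).im) (x : X) :
    η ≤ Real.sqrt (z.im + (S (BB.imag u) x).re) * Real.sqrt (w.im + (S (BB.imag v) x).re) := by
  have h1 := nonneg_S hS hu x
  have h2 := nonneg_S hS hv x
  rw [← Real.sqrt_mul (by linarith)]
  exact Real.le_sqrt_of_sq_le (by rw [sq]; gcongr <;> linarith)

/-- Strict contraction in the hyperbolic distance. -/
theorem contraction {z w : ℂ} {η d : ℝ} (hη : 0 < η) (hz : η ≤ z.im) (hw : η ≤ w.im)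
    (hd : 0 ≤ d) (h : ∀ x, ‖(m z - m w) x‖ ≤ d * Real.sqrt ((m z x).im * (m w x).im)) (x : X) :
    ‖(m z - m w) x‖ ≤ (‖z - w‖ / η + d * (‖S‖ / η / (η + ‖S‖ / η))) *
      Real.sqrt ((m z x).im * (m w x).im) := by
  have hz0 := hη.trans_le hz
  have hw0 := hη.trans_le hw
  have hp0 : ∀ y, 0 ≤ (m z y).im := fun y => (H.im_pos z hz0 y).le
  have hr0 : ∀ y, 0 ≤ (m w y).im := fun y => (H.im_pos w hw0 y).le
  have hP : 0 < z.im + (S (BB.imag (m z)) x).re := add_pos_of_pos_of_nonneg hz0 (nonneg_S hS hp0 x)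
  have hR : 0 < w.im + (S (BB.imag (m w)) x).re := add_pos_of_pos_of_nonneg hw0 (nonneg_S hS hr0 x)
  have h1 := hS.positive.norm_le_of_weight hd (Real.sqrt_pos.2 hP) (Real.sqrt_pos.2 hR) hp0 hr0 h
    ((H.S_imag_le_mul ha hS hη hz x).trans_eq (by rw [Real.sq_sqrt hP.le]))
    ((H.S_imag_le_mul ha hS hη hw x).trans_eq (by rw [Real.sq_sqrt hR.le]))
  rw [ContinuousLinearMap.coe_coe] at h1
  have h2 := le_sqrt_mul_sqrt hS hη hz hw hp0 hr0 x
  rw [H.sqrt_im_mul ha hS hz0 hw0, H.sub_eq hz0 hw0, norm_mul, norm_mul]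
  generalize Real.sqrt (z.im + (S (BB.imag (m z)) x).re) *
    Real.sqrt (w.im + (S (BB.imag (m w)) x).re) = Q at *
  generalize ‖S‖ / η / (η + ‖S‖ / η) = lam at *
  have h3 : ‖z - w‖ ≤ ‖z - w‖ / η * Q := by
    rw [div_mul_eq_mul_div, le_div_iff₀ hη]
    exact mul_le_mul_of_nonneg_left h2 (norm_nonneg _)
  have h4 : ‖z - w + S (m z - m w) x‖ ≤ (‖z - w‖ / η + d * lam) * Q :=
    (norm_add_le _ _).trans (by linarith)
  exact (mul_le_mul_of_nonneg_left h4 (by positivity)).trans (le_of_eq (by ring))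

omit ha hS in
theorem exists_le_norm {z : ℂ} (hz : 0 < z.im) : ∃ c : ℝ, 0 < c ∧ ∀ x, c ≤ ‖m z x‖ := by
  have h1 := H.inv_norm_le hz (norm_apply_le_opNorm S _)
  have h2 : 0 < ‖z‖ := norm_pos_iff.2 fun h => by simp [h] at hz
  have h3 : 0 ≤ ‖S‖ * ‖m z‖ := mul_nonneg S.opNorm_nonneg (norm_nonneg _)
  exact ⟨1 / (‖z‖ + ‖a‖ + ‖S‖ * ‖m z‖), by positivity, fun x =>
    (div_le_iff₀ (by positivity)).2 (h1 x)⟩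

/-- A quantitative Lipschitz bound away from the real line. -/
theorem norm_sub_le {z w : ℂ} {η : ℝ} (hη : 0 < η) (hz : η ≤ z.im) (hw : η ≤ w.im) :
    ‖m z - m w‖ ≤ (η + ‖S‖ / η) / η ^ 3 * ‖z - w‖ := by
  have hS0 : 0 ≤ ‖S‖ / η := div_nonneg S.opNorm_nonneg hη.le
  rcases isEmpty_or_nonempty X with hX | hX
  · exact BB.norm_le (by positivity) fun x => hX.elim x
  have hz0 := hη.trans_le hz
  have hw0 := hη.trans_le hw
  have hp0 : ∀ y, 0 < (m z y).im := H.im_pos z hz0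
  have hr0 : ∀ y, 0 < (m w y).im := H.im_pos w hw0
  have hsq0 : ∀ x, 0 < Real.sqrt ((m z x).im * (m w x).im) := fun x =>
    Real.sqrt_pos.2 (mul_pos (hp0 x) (hr0 x))
  -- A uniform lower bound makes the hyperbolic ratio bounded, so the supremum d below is a genuine
  -- one and not the default value.
  obtain ⟨c, hc, hcs⟩ : ∃ c, 0 < c ∧ ∀ x, c ≤ Real.sqrt ((m z x).im * (m w x).im) := by
    obtain ⟨c₁, hc₁, h₁⟩ := H.exists_le_norm hz0
    obtain ⟨c₂, hc₂, h₂⟩ := H.exists_le_norm hw0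
    refine ⟨c₁ * c₂ * η, by positivity, fun x => ?_⟩
    rw [H.sqrt_im_mul ha hS hz0 hw0]
    exact mul_le_mul (mul_le_mul (h₁ x) (h₂ x) hc₂.le (norm_nonneg _))
      (le_sqrt_mul_sqrt hS hη hz hw (fun y => (hp0 y).le) (fun y => (hr0 y).le) x) hη.le
      (by positivity)
  have hbdd : BddAbove (Set.range fun x =>
      ‖(m z - m w) x‖ / Real.sqrt ((m z x).im * (m w x).im)) := by
    refine ⟨‖m z - m w‖ / c, ?_⟩
    rintro _ ⟨x, rfl⟩
    exact div_le_div₀ (norm_nonneg _) (BB.norm_apply_le _ x) hc (hcs x)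
  obtain ⟨d, hd⟩ : ∃ d, d = ⨆ x, ‖(m z - m w) x‖ / Real.sqrt ((m z x).im * (m w x).im) := ⟨_, rfl⟩
  have hd0 : 0 ≤ d := hd ▸ Real.iSup_nonneg fun x => by positivity
  have hΔd : ∀ x, ‖(m z - m w) x‖ ≤ d * Real.sqrt ((m z x).im * (m w x).im) := fun x =>
    (div_le_iff₀ (hsq0 x)).1 (hd ▸ le_ciSup hbdd x)
  -- The contraction bounds d by itself with a factor below 1, so it can be solved for d.
  have hstep : d ≤ ‖z - w‖ / η + d * (‖S‖ / η / (η + ‖S‖ / η)) := by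
    conv_lhs => rw [hd]
    exact ciSup_le fun x => (div_le_iff₀ (hsq0 x)).2 (H.contraction ha hS hη hz hw hd0 hΔd x)
  clear hd hbdd
  have hd1 : d ≤ (η + ‖S‖ / η) / η ^ 2 * ‖z - w‖ := by
    generalize ‖S‖ / η = σ at *
    have h1 : 1 - σ / (η + σ) = η / (η + σ) := by field_simp; ring
    have h2 : d * (η / (η + σ)) ≤ ‖z - w‖ / η := by rw [← h1]; linarith
    rw [← mul_div_assoc, div_le_div_iff₀ (by positivity) hη] at h2
    rw [div_mul_eq_mul_div, le_div_iff₀ (by positivity)]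
    linarith
  refine BB.norm_le (by positivity) fun x => (hΔd x).trans ?_
  have h1 : Real.sqrt ((m z x).im * (m w x).im) ≤ 1 / η := by
    refine Real.sqrt_le_iff.2 ⟨by positivity, ?_⟩
    have h2 : (m z x).im ≤ 1 / η := ((le_abs_self _).trans (Complex.abs_im_le_norm _)).trans
      ((H.norm_apply_le ha hS hz0 x).trans (by gcongr))
    have h3 : (m w x).im ≤ 1 / η := ((le_abs_self _).trans (Complex.abs_im_le_norm _)).trans
      ((H.norm_apply_le ha hS hw0 x).trans (by gcongr))
    rw [sq]
    exact mul_le_mul h2 h3 (hr0 x).le (by positivity)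
  refine (mul_le_mul hd1 h1 (Real.sqrt_nonneg _) (by positivity)).trans (le_of_eq ?_)
  field_simp

/-- The local form of the Lipschitz bound. -/
theorem eventually_norm_sub_le {z : ℂ} (hz : 0 < z.im) :
    ∃ C : ℝ, 0 ≤ C ∧ ∀ᶠ w in nhds z, 0 < w.im ∧ ‖m z - m w‖ ≤ C * ‖z - w‖ := by
  refine ⟨(z.im / 2 + ‖S‖ / (z.im / 2)) / (z.im / 2) ^ 3, by positivity, ?_⟩
  have : ∀ᶠ w in nhds z, z.im / 2 < w.im :=
    (isOpen_lt continuous_const Complex.continuous_im).mem_nhds (by simp; linarith)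
  filter_upwards [this] with w hw
  exact ⟨by linarith, H.norm_sub_le ha hS (by positivity) (by linarith) hw.le⟩

theorem continuousAt {z : ℂ} (hz : 0 < z.im) : ContinuousAt m z := by
  obtain ⟨C, hC, h⟩ := H.eventually_norm_sub_le ha hS hz
  rw [ContinuousAt, tendsto_iff_norm_sub_tendsto_zero]
  have h1 : Filter.Tendsto (fun w => C * ‖z - w‖) (nhds z) (nhds 0) := by
    have : ContinuousAt (fun w => C * ‖z - w‖) z := by fun_prop
    simpa [ContinuousAt] using this
  refine squeeze_zero' (Filter.Eventually.of_forall fun _ => norm_nonneg _) ?_ h1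
  filter_upwards [h] with w hw
  rw [norm_sub_rev]
  exact hw.2

end

end IsSolution

/-! ### Linearisation and a priori bounds -/

/-- The standing assumptions on the data `a`, `S` of the quadratic vector equation and its
solution `m`. The constant `K` bounds `S` as an operator from `L²` to the bounded functions. -/
structure Setting (μ : Measure X) [IsProbabilityMeasure μ] (a : BB X) (S : BB X →L[ℂ] BB X)
    (m : ℂ → BB X) (A K ρ : ℝ) (L : ℕ) : Prop where
  real : ∀ x, (a x).im = 0
  norm_le : ‖a‖ ≤ A
  sp : SymmetricPositive μ S
  smoothing : ∀ u x, ‖S u x‖ ≤ K * ‖BB.toL2 μ u‖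
  primitive : UniformlyPrimitive μ S L ρ
  sol : IsSolution a S m

namespace Setting

variable {μ : Measure X} [IsProbabilityMeasure μ] {a : BB X} {S : BB X →L[ℂ] BB X}
  {m : ℂ → BB X} {A K ρ : ℝ} {L : ℕ}

theorem solutionBounds (E : Setting μ a S m A K ρ L) {z : ℂ} {c Λ τ : ℝ} (hz : 0 < z.im)
    (hc : 0 < c) (hcm : ∀ x, c ≤ ‖m z x‖) (hΛ : ‖BB.toL2 μ (m z)‖ ≤ Λ)
    (hτ : ∀ x, z.im + (S (BB.imag (m z)) x).re ≤ τ) :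
    SolutionBounds μ (S : BB X →ₗ[ℂ] BB X) L ρ (m z) z.im c Λ τ where
  symm := E.sp.symm
  positive := E.sp.positive
  one_le := E.primitive.one_le
  rho_pos := E.primitive.pos
  le_pow u hu x := by
    have := E.primitive.le_pow u hu x
    rwa [← ContinuousLinearMap.coe_coe, ContinuousLinearMap.toLinearMap_pow] at this
  im_pos := E.sol.im_pos z hz
  im_eq := E.sol.im_eq E.real E.sp hz
  eta_pos := hz
  c_pos := hc
  c_le := hcm
  norm_le := hΛ
  le_tau := hτ

/-- The linearised equation for the difference of two nearby values of the solution. -/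
theorem eventually_linearised (E : Setting μ a S m A K ρ L) {z : ℂ} {Λ : ℝ} (hz : 0 < z.im)
    (hΛ : ‖BB.toL2 μ (m z)‖ ≤ Λ) :
    ∀ᶠ z' in nhds z, 0 < z'.im ∧ ∃ w g : BB X,
      (∀ x, (starRingEnd ℂ) (m z x) / m z x * w x =
        sandwich (BB.abs (m z)) (S : BB X →ₗ[ℂ] BB X) w x + g x) ∧
      (∀ x, (m z - m z') x = (‖m z x‖ : ℂ) * w x) ∧
      ‖BB.toL2 μ g‖ ≤ (Λ + 1) * ‖z - z'‖ := by
  obtain ⟨C, hC, h⟩ := E.sol.eventually_norm_sub_le E.real E.sp hz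
  obtain ⟨c, hc, hcm⟩ := E.sol.exists_le_norm hz
  have hS0 : 0 ≤ ‖S‖ := S.opNorm_nonneg
  -- C depends on Im z, but it enters only through the size of the neighbourhood. The quadratic
  -- error e is then at most |z - z'|, with constant 1.
  have hsmall : ∀ᶠ z' in nhds z, C * ‖z - z'‖ * (1 + ‖S‖ * C) < 1 := by
    have : ContinuousAt (fun z' => C * ‖z - z'‖ * (1 + ‖S‖ * C)) z := by fun_prop
    refine this.eventually_lt continuousAt_const ?_
    simp
  filter_upwards [h, hsmall] with z' ⟨hz', hC'⟩ hs
  refine ⟨hz', ?_⟩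
  have hm0 : ∀ x, (‖m z x‖ : ℂ) ≠ 0 := fun x =>
    Complex.ofReal_ne_zero.2 (norm_ne_zero_iff.2 (E.sol.ne_zero hz x))
  set Δ := m z - m z' with hΔ
  set ph : BB X := BB.mk (fun x => (‖m z x‖ : ℂ) / m z x)
    ((Complex.measurable_ofReal.comp (BB.meas (m z)).norm).div (BB.meas (m z)))
    ⟨1, fun x => by
      rw [norm_div, Complex.norm_real, norm_norm,
        div_self (norm_ne_zero_iff.2 (E.sol.ne_zero hz x))]⟩ with hph
  set w : BB X := BB.mk (fun x => Δ x / (‖m z x‖ : ℂ))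
    ((BB.meas Δ).div (Complex.measurable_ofReal.comp (BB.meas (m z)).norm))
    ⟨‖Δ‖ / c, fun x => by
      rw [norm_div, Complex.norm_real, norm_norm]
      exact div_le_div₀ (norm_nonneg _) (BB.norm_apply_le Δ x) hc (hcm x)⟩ with hw
  set e : BB X := BB.mul ph (BB.mul Δ (BB.const (z - z') + S Δ)) with he
  have hwΔ : BB.mul (BB.abs (m z)) w = Δ := BB.ext_apply fun x => by
    rw [BB.mul_apply, BB.abs_apply, hw, BB.mk_apply, mul_div_cancel₀ _ (hm0 x)]
  have hlin : ∀ x, (starRingEnd ℂ) (m z x) / m z x * w x =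
      sandwich (BB.abs (m z)) (S : BB X →ₗ[ℂ] BB X) w x +
        ((z - z') • BB.abs (m z) - e) x := by
    intro x
    have h1 := E.sol.sub_eq hz hz' x
    have h0 := E.sol.ne_zero hz x
    have h0' := hm0 x
    have h2 : (starRingEnd ℂ) (m z x) = (‖m z x‖ : ℂ) ^ 2 / m z x := by
      rw [eq_div_iff h0, Complex.conj_mul']
    have h3 : m z' x = m z x - Δ x := by rw [hΔ, BB.sub_apply]; ring
    rw [← hΔ, h3] at h1
    rw [sandwich_apply, hwΔ, h2, BB.sub_apply, BB.smul_apply, he, BB.mul_apply, BB.mul_apply,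
      BB.add_apply, BB.const_apply, BB.abs_apply, hw, hph, BB.mk_apply, BB.mk_apply,
      ContinuousLinearMap.coe_coe]
    generalize Δ x = d at *
    generalize S Δ x = s at *
    generalize hq : (‖m z x‖ : ℂ) = q at *
    generalize m z x = n at *
    have h4 : d = n * (n - d) * (z - z' + s) := h1
    field_simp
    linear_combination h4
  have hΔw : ∀ x, Δ x = (‖m z x‖ : ℂ) * w x := by
    intro x
    rw [hw, BB.mk_apply, mul_div_cancel₀ _ (hm0 x)]
  have hg : ‖BB.toL2 μ ((z - z') • BB.abs (m z) - e)‖ ≤ (Λ + 1) * ‖z - z'‖ := by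
    have he1 : ‖BB.toL2 μ e‖ ≤ ‖z - z'‖ := by
      refine (BB.norm_toL2_le_norm μ e).trans (BB.norm_le (norm_nonneg _) fun x => ?_)
      rw [he, BB.mul_apply, BB.mul_apply, norm_mul, norm_mul, hph, BB.mk_apply, norm_div,
        Complex.norm_real, norm_norm, div_self (norm_ne_zero_iff.2 (E.sol.ne_zero hz x)), one_mul,
        BB.add_apply, BB.const_apply]
      have h5 : ‖z - z' + S Δ x‖ ≤ ‖z - z'‖ * (1 + ‖S‖ * C) := by
        refine (norm_add_le _ _).trans ?_
        have h6 := (norm_apply_le_opNorm S Δ x).trans (mul_le_mul_of_nonneg_left hC' hS0)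
        linarith
      have h7 : ‖Δ x‖ ≤ C * ‖z - z'‖ := (BB.norm_apply_le Δ x).trans hC'
      have h8 := mul_le_mul h7 h5 (norm_nonneg _) (by positivity)
      have h9 := mul_le_mul_of_nonneg_right hs.le (norm_nonneg (z - z'))
      linarith
    rw [BB.toL2_sub, BB.toL2_smul]
    refine (norm_sub_le _ _).trans ?_
    rw [norm_smul, SolutionBounds.norm_abs]
    have := mul_le_mul_of_nonneg_left hΛ (norm_nonneg (z - z'))
    linarith
  exact ⟨w, (z - z') • BB.abs (m z) - e, hlin, hΔw, hg⟩

/-- A uniform lower bound on the modulus of the solution. -/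
theorem le_norm (E : Setting μ a S m A K ρ L) {z : ℂ} {R Λ : ℝ} (hz : 0 < z.im) (hR : ‖z‖ ≤ R)
    (hK : 0 ≤ K) (hΛ : ‖BB.toL2 μ (m z)‖ ≤ Λ) (x : X) : 1 / (R + A + K * Λ) ≤ ‖m z x‖ := by
  have h1 := E.sol.inv_norm_le hz (b := K * Λ) (fun y => (E.smoothing _ y).trans (by gcongr)) x
  have h2 : 0 < ‖z‖ := norm_pos_iff.2 fun h => by simp [h] at hz
  have h3 : 0 ≤ K * Λ := mul_nonneg hK ((norm_nonneg _).trans hΛ)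
  have h4 := E.norm_le
  have h5 := norm_nonneg a
  rw [div_le_iff₀ (by linarith)]
  exact h1.trans (by gcongr)

theorem S_imag_le (E : Setting μ a S m A K ρ L) (z : ℂ) (x : X) :
    (S (BB.imag (m z)) x).re ≤ K * ‖BB.toL2 μ (BB.imag (m z))‖ :=
  (Complex.re_le_norm _).trans (E.smoothing _ x)

theorem norm_toL2_imag_le (u : BB X) : ‖BB.toL2 μ (BB.imag u)‖ ≤ ‖BB.toL2 μ u‖ :=
  BB.norm_toL2_mono μ fun x => by
    rw [BB.imag_apply, Complex.norm_real, Real.norm_eq_abs]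
    exact Complex.abs_im_le_norm _

/-- If `m` is bounded, then `S Im m` is controlled by the density. -/
theorem le_tau_of_bounded (E : Setting μ a S m A K ρ L) {z : ℂ} {c Φ : ℝ} (hz : 0 < z.im)
    (hK : 0 ≤ K) (hc : 0 < c) (hcm : ∀ x, c ≤ ‖m z x‖) (hΦ : ∀ x, ‖m z x‖ ≤ Φ) (x : X) :
    z.im + (S (BB.imag (m z)) x).re ≤
      (1 / c ^ 2 + K * Real.sqrt (2 * Φ ^ 2 / c ^ 2 + Φ ^ 4 * K ^ 2)) *
        SolutionBounds.dens μ (m z) := by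
  have hS0 : 0 ≤ ‖S‖ := S.opNorm_nonneg
  have D := E.solutionBounds (Λ := ‖BB.toL2 μ (m z)‖) (τ := z.im + ‖S‖ / z.im) hz hc hcm le_rfl
    (fun y => add_le_add_right (E.sol.S_imag_le E.real E.sp hz y) _)
  set v := SolutionBounds.dens μ (m z) with hv
  have hv0 : 0 < v := D.dens_pos
  have hηv : z.im ≤ 1 / c ^ 2 * v := by
    have : ∫ _, c ^ 2 * z.im ∂μ ≤ v :=
      integral_mono (integrable_const _) ((BB.integrable μ (m z)).im) fun x => D.im_ge x
    simp only [integral_const, probReal_univ, one_smul] at this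
    rw [div_mul_eq_mul_div, le_div_iff₀ (by positivity)]
    linarith
  set y := ‖BB.toL2 μ (BB.imag (m z))‖ with hy
  have hy0 : 0 ≤ y := norm_nonneg _
  have hb : ∀ t, (m z t).im ≤ Φ ^ 2 * (z.im + K * y) := fun t => by
    rw [D.im_eq t]
    have h1 := E.S_imag_le z t
    have h2 := D.nonneg_S t
    rw [ContinuousLinearMap.coe_coe] at h2 ⊢
    exact mul_le_mul (pow_le_pow_left₀ (norm_nonneg _) (hΦ t) 2) (by linarith) (by linarith)
      (sq_nonneg _)
  -- ‖Im m‖₂² ≤ sup(Im m) · v, and sup(Im m) is itself bounded by y = ‖Im m‖₂. This quadratic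
  -- inequality, with η ≤ v/c², gives y ≲ v.
  have hy2 : y ^ 2 ≤ Φ ^ 2 * (z.im + K * y) * v := by
    rw [hy, BB.norm_toL2_sq, hv, SolutionBounds.dens, ← integral_const_mul]
    refine integral_mono (BB.integrable_norm_sq μ _) (((BB.integrable μ (m z)).im).const_mul _)
      fun t => ?_
    have h3 := (E.sol.im_pos z hz t).le
    simp only [BB.imag_apply, Complex.norm_real, Real.norm_eq_abs, sq_abs]
    rw [sq]
    exact mul_le_mul_of_nonneg_right (hb t) h3
  have hy3 : y ≤ Real.sqrt (2 * Φ ^ 2 / c ^ 2 + Φ ^ 4 * K ^ 2) * v := by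
    rw [← Real.sqrt_sq hv0.le, ← Real.sqrt_mul (by positivity)]
    refine Real.le_sqrt_of_sq_le ?_
    have h4 : Φ ^ 2 * z.im * v ≤ Φ ^ 2 * (1 / c ^ 2 * v) * v := by gcongr
    have h5 : Φ ^ 2 * (1 / c ^ 2 * v) * v = Φ ^ 2 / c ^ 2 * v ^ 2 := by ring
    have h6 : 2 * Φ ^ 2 / c ^ 2 * v ^ 2 = 2 * (Φ ^ 2 / c ^ 2 * v ^ 2) := by ring
    nlinarith [sq_nonneg (y - Φ ^ 2 * K * v)]
  have h7 := E.S_imag_le z x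
  have h8 := mul_le_mul_of_nonneg_left hy3 hK
  linarith

end Setting

/-! ### Balancing the two stability bounds -/

/-- Optimisation of the two stability bounds for bounded solutions. -/
theorem stability_bounded {T Φ β : ℝ} (hT : 0 < T) (hΦ : 0 < Φ) (hβ : 0 < β) :
    ∃ C : ℝ, 0 < C ∧ ∀ v y N G : ℝ, 0 < v → 0 < y → 0 ≤ G → v ≤ Φ →
      N ≤ 2 * (T * v) / y ^ 3 * G →
      (y ^ 3 * Φ ^ 3 ≤ v ^ 2 / 2 → 16 * Φ ^ 4 * (β * v) * y ^ 3 ≤ v ^ 4 →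
        N ≤ (25 * (T * v) ^ 2 * Φ ^ 6 * (β * v) / v ^ 5 + 4 * (T * v) * Φ ^ 3 / v ^ 2) * G) →
      N ≤ C / y ^ 2 * G := by
  obtain ⟨k, hk0, hk1, hk2⟩ : ∃ k : ℝ, 0 < k ∧ k ^ 3 * (2 * Φ ^ 4) ≤ 1 ∧
      k ^ 3 * (16 * Φ ^ 4 * β) ≤ 1 := by
    refine ⟨1 / (1 + 2 * Φ ^ 4 + 16 * Φ ^ 4 * β), by positivity, ?_, ?_⟩
    all_goals
      set Q := 1 + 2 * Φ ^ 4 + 16 * Φ ^ 4 * β with hQ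
      have hQ1 : 1 ≤ Q := by
        have : 0 ≤ 2 * Φ ^ 4 + 16 * Φ ^ 4 * β := by positivity
        linarith
      rw [div_pow, one_pow, div_mul_eq_mul_div, div_le_one (by positivity), one_mul]
      refine le_trans ?_ (le_self_pow₀ hQ1 three_ne_zero)
      have : 0 ≤ Φ ^ 4 * β := by positivity
      have : 0 ≤ Φ ^ 4 := by positivity
      linarith
  refine ⟨(25 * T ^ 2 * Φ ^ 6 * β + 4 * T * Φ ^ 4) * k ^ 2 + 2 * T / k, by positivity, ?_⟩
  intro v y N G hv hy hG hvΦ h1 h2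
  -- Here y = η^(1/3). For y ≤ kv both smallness conditions hold, by the choice of k, and the bound
  -- v⁻² applies; otherwise v/η ≲ y⁻².
  rcases le_total y (k * v) with h | h
  · have h3 : y ^ 3 ≤ k ^ 3 * v ^ 3 := by
      rw [← mul_pow]; exact pow_le_pow_left₀ hy.le h 3
    have h4 := h2 (by
      have h5 : y ^ 3 * Φ ^ 3 ≤ k ^ 3 * v ^ 3 * Φ ^ 3 := by gcongr
      have h6 : k ^ 3 * v ^ 3 * Φ ^ 3 ≤ k ^ 3 * (v ^ 2 * Φ) * Φ ^ 3 := by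
        have : v ^ 3 ≤ v ^ 2 * Φ := by rw [pow_succ]; gcongr
        gcongr
      have h7 : k ^ 3 * (2 * Φ ^ 4) * v ^ 2 ≤ 1 * v ^ 2 := by gcongr
      linarith) (by
      have h5 : 16 * Φ ^ 4 * (β * v) * y ^ 3 ≤ 16 * Φ ^ 4 * (β * v) * (k ^ 3 * v ^ 3) := by gcongr
      have h7 : k ^ 3 * (16 * Φ ^ 4 * β) * v ^ 4 ≤ 1 * v ^ 4 := by gcongr
      linarith)
    refine h4.trans (mul_le_mul_of_nonneg_right ?_ hG)
    have h5 : 1 / v ≤ k / y := by rw [div_le_div_iff₀ hv hy]; linarith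
    have h6 : (1 / v) ^ 2 ≤ (k / y) ^ 2 := by gcongr
    have h7 : 25 * (T * v) ^ 2 * Φ ^ 6 * (β * v) / v ^ 5 + 4 * (T * v) * Φ ^ 3 / v ^ 2 ≤
        (25 * T ^ 2 * Φ ^ 6 * β + 4 * T * Φ ^ 4) * (1 / v) ^ 2 := by
      have h8 : 4 * (T * v) * Φ ^ 3 / v ^ 2 ≤ 4 * T * Φ ^ 4 * (1 / v) ^ 2 := by
        rw [div_pow, one_pow, mul_one_div]
        refine div_le_div_of_nonneg_right ?_ (by positivity)
        have : T * Φ ^ 3 * v ≤ T * Φ ^ 3 * Φ := by gcongr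
        linarith
      have h9 : 25 * (T * v) ^ 2 * Φ ^ 6 * (β * v) / v ^ 5 =
          25 * T ^ 2 * Φ ^ 6 * β * (1 / v) ^ 2 := by field_simp
      rw [h9]
      linarith
    refine h7.trans ((mul_le_mul_of_nonneg_left h6 (by positivity)).trans ?_)
    have h10 : (25 * T ^ 2 * Φ ^ 6 * β + 4 * T * Φ ^ 4) * (k / y) ^ 2 =
        (25 * T ^ 2 * Φ ^ 6 * β + 4 * T * Φ ^ 4) * k ^ 2 / y ^ 2 := by ring
    rw [h10]
    have : 0 ≤ 2 * T / k := by positivity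
    gcongr
    linarith
  · refine h1.trans (mul_le_mul_of_nonneg_right ?_ hG)
    have h5 : 2 * (T * v) / y ^ 3 ≤ 2 * T / k / y ^ 2 := by
      rw [div_div, div_le_div_iff₀ (by positivity) (by positivity)]
      have : T * y ^ 2 * (k * v) ≤ T * y ^ 2 * y := by gcongr
      linarith
    refine h5.trans ?_
    have : 0 ≤ (25 * T ^ 2 * Φ ^ 6 * β + 4 * T * Φ ^ 4) * k ^ 2 := by positivity
    gcongr
    linarith

/-- Optimisation of the two stability bounds for square integrable solutions. -/
theorem stability_L2 {τ Λ β Y : ℝ} (hτ : 0 < τ) (hΛ : 0 < Λ) (hβ : 0 < β) (hY : 0 < Y) :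
    ∃ C : ℝ, 0 < C ∧ ∀ v y N G I : ℝ, 0 < v → 0 < y → y ≤ Y → 0 ≤ G → 0 ≤ I → v ≤ Λ →
      I ^ 2 ≤ 4 * τ * v / (y ^ 13) ^ 2 * G ^ 2 → I ≤ Λ * N →
      (y ^ 13 * Λ ^ 3 ≤ v ^ 2 / 2 → 16 * Λ ^ 4 * β * y ^ 13 ≤ v ^ 4 →
        N ≤ (25 * τ ^ 2 * Λ ^ 6 * β / v ^ 5 + 4 * τ * Λ ^ 3 / v ^ 2) * G) →
      I ≤ C / y ^ 12 * G := by
  obtain ⟨k, hk0, hk1, hk2⟩ : ∃ k : ℝ, 0 < k ∧ k ^ 4 * (2 * Y ^ 5 * Λ ^ 5) ≤ 1 ∧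
      k ^ 4 * (16 * Λ ^ 4 * β * Y ^ 5) ≤ 1 := by
    refine ⟨1 / (1 + 2 * Y ^ 5 * Λ ^ 5 + 16 * Λ ^ 4 * β * Y ^ 5), by positivity, ?_, ?_⟩
    all_goals
      set Q := 1 + 2 * Y ^ 5 * Λ ^ 5 + 16 * Λ ^ 4 * β * Y ^ 5 with hQ
      have hQ0 : 0 ≤ 2 * Y ^ 5 * Λ ^ 5 := by positivity
      have hQ0' : 0 ≤ 16 * Λ ^ 4 * β * Y ^ 5 := by positivity
      have hQ1 : 1 ≤ Q := by linarith
      rw [div_pow, one_pow, div_mul_eq_mul_div, div_le_one (by positivity), one_mul]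
      refine le_trans ?_ (le_self_pow₀ hQ1 four_ne_zero)
      linarith
  set M := 25 * τ ^ 2 * Λ ^ 6 * β + 4 * τ * Λ ^ 6 with hM
  have hM0 : 0 < M := by positivity
  refine ⟨Λ * (M * (k ^ 5 * Y ^ 2)) + Real.sqrt (4 * τ / k), by positivity, ?_⟩
  intro v y N G I hv hy hyY hG hI hvΛ h1 hIN h2
  -- Here y = η^(1/13), so the threshold is v ~ η^(2/13). For small v, √v/η ≲ y⁻¹². For large v, v⁻⁵
  -- ≲ y⁻¹⁰, and the spare factor y² is bounded by Y².
  rcases le_total (y ^ 2) (k * v) with h | h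
  · have h3 : y ^ 13 ≤ Y ^ 5 * (k ^ 4 * v ^ 4) := by
      have h4 : (y ^ 2) ^ 4 ≤ (k * v) ^ 4 := by gcongr
      have h5 : y ^ 5 ≤ Y ^ 5 := by gcongr
      calc y ^ 13 = y ^ 5 * (y ^ 2) ^ 4 := by ring
        _ ≤ Y ^ 5 * (k * v) ^ 4 := by gcongr
        _ = Y ^ 5 * (k ^ 4 * v ^ 4) := by ring
    have h4 := h2 (by
      have h5 : y ^ 13 * Λ ^ 3 ≤ Y ^ 5 * (k ^ 4 * v ^ 4) * Λ ^ 3 := by gcongr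
      have h6 : v ^ 4 ≤ v ^ 2 * Λ ^ 2 := by
        rw [show v ^ 4 = v ^ 2 * v ^ 2 by ring]; gcongr
      have h7 : Y ^ 5 * (k ^ 4 * v ^ 4) * Λ ^ 3 ≤ Y ^ 5 * (k ^ 4 * (v ^ 2 * Λ ^ 2)) * Λ ^ 3 := by
        gcongr
      have h8 : k ^ 4 * (2 * Y ^ 5 * Λ ^ 5) * v ^ 2 ≤ 1 * v ^ 2 := by gcongr
      linarith) (by
      have h5 : 16 * Λ ^ 4 * β * y ^ 13 ≤ 16 * Λ ^ 4 * β * (Y ^ 5 * (k ^ 4 * v ^ 4)) := by gcongr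
      have h7 : k ^ 4 * (16 * Λ ^ 4 * β * Y ^ 5) * v ^ 4 ≤ 1 * v ^ 4 := by gcongr
      linarith)
    have h5 : 1 / v ≤ k / y ^ 2 := by rw [div_le_div_iff₀ hv (by positivity)]; linarith
    have h7 : 25 * τ ^ 2 * Λ ^ 6 * β / v ^ 5 + 4 * τ * Λ ^ 3 / v ^ 2 ≤ M * (1 / v) ^ 5 := by
      have h8 : 4 * τ * Λ ^ 3 / v ^ 2 ≤ 4 * τ * Λ ^ 6 * (1 / v) ^ 5 := by
        rw [div_pow, one_pow, mul_one_div, div_le_div_iff₀ (by positivity) (by positivity)]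
        have : τ * Λ ^ 3 * v ^ 2 * v ^ 3 ≤ τ * Λ ^ 3 * v ^ 2 * Λ ^ 3 := by gcongr
        linarith
      have h9 : 25 * τ ^ 2 * Λ ^ 6 * β / v ^ 5 = 25 * τ ^ 2 * Λ ^ 6 * β * (1 / v) ^ 5 := by
        field_simp
      rw [h9, hM]
      linarith
    have h10 : M * (1 / v) ^ 5 ≤ M * (k ^ 5 * Y ^ 2) / y ^ 12 := by
      have h11 : (1 / v) ^ 5 ≤ (k / y ^ 2) ^ 5 := by gcongr
      have h12 : (k / y ^ 2) ^ 5 = k ^ 5 * y ^ 2 / y ^ 12 := by field_simp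
      have h13 : k ^ 5 * y ^ 2 / y ^ 12 ≤ k ^ 5 * Y ^ 2 / y ^ 12 := by gcongr
      rw [mul_div_assoc]
      gcongr
      linarith
    have h14 : N ≤ M * (k ^ 5 * Y ^ 2) / y ^ 12 * G :=
      h4.trans (mul_le_mul_of_nonneg_right (h7.trans h10) hG)
    have h15 : Λ * N ≤ Λ * (M * (k ^ 5 * Y ^ 2) / y ^ 12 * G) := by gcongr
    have h16 : 0 ≤ Real.sqrt (4 * τ / k) / y ^ 12 * G := by positivity
    rw [add_div, add_mul, mul_div_assoc]
    linarith
  · have h3 : I ≤ Real.sqrt (4 * τ / k) / y ^ 12 * G := by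
      refine le_of_sq_le_sq (h1.trans ?_) (by positivity)
      rw [mul_pow, div_pow, Real.sq_sqrt (by positivity)]
      refine mul_le_mul_of_nonneg_right ?_ (sq_nonneg _)
      rw [div_div, div_le_div_iff₀ (by positivity) (by positivity)]
      have : 4 * τ * y ^ 24 * (k * v) ≤ 4 * τ * y ^ 24 * y ^ 2 := by gcongr
      linarith
    have h4 : 0 ≤ Λ * (M * (k ^ 5 * Y ^ 2)) / y ^ 12 * G := by positivity
    rw [add_div, add_mul]
    linarith

/-! ### Local Lipschitz bounds in terms of Im z -/

theorem avg_sub (μ : Measure X) [IsProbabilityMeasure μ] (u w : BB X) :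
    avg μ u - avg μ w = ∫ x, (u - w) x ∂μ :=
  (integral_sub (BB.integrable μ u) (BB.integrable μ w)).symm

theorem norm_avg_sub_le (μ : Measure X) [IsProbabilityMeasure μ] (u w : BB X) :
    ‖avg μ u - avg μ w‖ ≤ ‖u - w‖ := by
  rw [avg_sub]
  simpa using norm_integral_le_of_norm_le_const (μ := μ)
    (Filter.Eventually.of_forall (BB.norm_apply_le (u - w)))

theorem norm_avg_le (μ : Measure X) [IsProbabilityMeasure μ] (u : BB X) :
    ‖avg μ u‖ ≤ ‖BB.toL2 μ u‖ := by
  have h := BB.norm_integral_mul_le μ (BB.const 1) u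
  simp only [BB.const_apply, one_mul] at h
  exact h.trans (mul_le_of_le_one_left (norm_nonneg _)
    ((BB.norm_toL2_le_norm μ _).trans (BB.norm_le zero_le_one fun x => by simp)))

theorem rpow_root_pow {η : ℝ} (hη : 0 < η) (n : ℕ) (hn : n ≠ 0) :
    (η ^ (1 / n : ℝ)) ^ n = η := by
  rw [← Real.rpow_natCast, ← Real.rpow_mul hη.le, one_div, inv_mul_cancel₀ (by exact_mod_cast hn),
    Real.rpow_one]

theorem div_rpow_root_pow {η : ℝ} (hη : 0 < η) (C : ℝ) (n k : ℕ) :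
    C / (η ^ (1 / n : ℝ)) ^ k = C * η ^ (-(k / n) : ℝ) := by
  rw [← Real.rpow_natCast, ← Real.rpow_mul hη.le, Real.rpow_neg hη.le, div_eq_mul_inv]
  congr 3
  ring

/-- The local Lipschitz bound for the average of a square integrable solution. -/
theorem exists_local_avg {A K ρ R Λ : ℝ} {L : ℕ} (hA : 0 ≤ A) (hK : 0 ≤ K) (hρ : 0 < ρ)
    (hL : 1 ≤ L) (hR : 0 < R) (hΛ : 0 < Λ) :
    ∃ C : ℝ, 0 < C ∧ ∀ (X : Type*) [MeasurableSpace X] (μ : Measure X) [IsProbabilityMeasure μ]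
      (a : BB X) (S : BB X →L[ℂ] BB X) (m : ℂ → BB X), Setting μ a S m A K ρ L →
      ∀ z : ℂ, 0 < z.im → ‖z‖ ≤ R → ‖BB.toL2 μ (m z)‖ ≤ Λ →
        ∀ᶠ z' in nhds z, ‖avg μ (m z) - avg μ (m z')‖ ≤
          C * z.im ^ (-(12 / 13) : ℝ) * ‖z - z'‖ := by
  set c := 1 / (R + A + K * Λ) with hc
  have hc0 : 0 < c := by positivity
  set τ := R + K * Λ with hτ
  have hτ0 : 0 < τ := by positivity
  have hL0 : (0 : ℝ) < L := by exact_mod_cast hL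
  obtain ⟨C, hC, h⟩ := stability_L2 (τ := τ) (Λ := Λ)
    (β := 4 * L * τ / (c ^ (2 * (L - 1)) * ρ)) (Y := R ^ (1 / (13 : ℕ) : ℝ)) hτ0 hΛ
    (by positivity) (by positivity)
  refine ⟨C * (Λ + 1), by positivity, ?_⟩
  intro X _ μ _ a S m E z hz hzR hzΛ
  obtain ⟨x₀⟩ : Nonempty X := nonempty_of_isProbabilityMeasure μ
  have : Nonempty X := ⟨x₀⟩
  have him : z.im ≤ R := ((le_abs_self _).trans (Complex.abs_im_le_norm z)).trans hzR
  have D := E.solutionBounds hz hc0 (E.le_norm hz hzR hK hzΛ) hzΛ (τ := τ) (fun x =>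
    add_le_add him ((E.S_imag_le z x).trans (mul_le_mul_of_nonneg_left
      ((Setting.norm_toL2_imag_le _).trans hzΛ) hK)))
  filter_upwards [E.eventually_linearised hz hzΛ] with z' ⟨hz', w, g, hw, hΔ, hg⟩
  have hI : avg μ (m z) - avg μ (m z') =
      inner ℂ (BB.toL2 μ (BB.abs (m z))) (BB.toL2 μ w) := by
    rw [avg_sub, BB.inner_toL2]
    refine integral_congr_ae (Filter.Eventually.of_forall fun x => ?_)
    simp only [hΔ, BB.abs_apply, Complex.conj_ofReal]
  have hpow := rpow_root_pow hz 13 (by norm_num)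
  have key := h (SolutionBounds.dens μ (m z)) (z.im ^ (1 / (13 : ℕ) : ℝ)) ‖BB.toL2 μ w‖
    ‖BB.toL2 μ g‖ ‖avg μ (m z) - avg μ (m z')‖ D.dens_pos (by positivity)
    (Real.rpow_le_rpow hz.le him (by positivity)) (norm_nonneg _) (norm_nonneg _) D.dens_le_Lam
    (by rw [hpow, hI]; exact D.norm_inner_sq_le_of_eta hw)
    (by
      rw [hI]
      refine (norm_inner_le_norm _ _).trans ?_
      rw [SolutionBounds.norm_abs]
      exact mul_le_mul_of_nonneg_right hzΛ (norm_nonneg _))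
    (by rw [hpow]; exact D.norm_le_of_dens hw)
  rw [div_rpow_root_pow hz] at key
  push_cast at key
  refine key.trans ((mul_le_mul_of_nonneg_left hg (by positivity)).trans (le_of_eq (by ring)))

/-- The local Lipschitz bound for a bounded solution. -/
theorem exists_local_norm {A K ρ R Φ : ℝ} {L : ℕ} (hA : 0 ≤ A) (hK : 0 ≤ K) (hρ : 0 < ρ)
    (hL : 1 ≤ L) (hR : 0 < R) (hΦ : 0 < Φ) :
    ∃ C : ℝ, 0 < C ∧ ∀ (X : Type*) [MeasurableSpace X] (μ : Measure X) [IsProbabilityMeasure μ]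
      (a : BB X) (S : BB X →L[ℂ] BB X) (m : ℂ → BB X), Setting μ a S m A K ρ L →
      ∀ z : ℂ, 0 < z.im → ‖z‖ ≤ R → ‖m z‖ ≤ Φ →
        ∀ᶠ z' in nhds z, ‖m z - m z'‖ ≤ C * z.im ^ (-(2 / 3) : ℝ) * ‖z - z'‖ := by
  set c := 1 / (R + A + K * Φ) with hc
  have hc0 : 0 < c := by positivity
  set T := 1 / c ^ 2 + K * Real.sqrt (2 * Φ ^ 2 / c ^ 2 + Φ ^ 4 * K ^ 2) with hT
  have hT0 : 0 < T := by positivity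
  have hL0 : (0 : ℝ) < L := by exact_mod_cast hL
  obtain ⟨C, hC, h⟩ := stability_bounded (T := T) (Φ := Φ)
    (β := 4 * L * T / (c ^ (2 * (L - 1)) * ρ)) hT0 hΦ (by positivity)
  set Y := R ^ (1 / (3 : ℕ) : ℝ) with hY
  refine ⟨Φ * (Φ + 1) * (Y ^ 2 + K * Φ * C * (Φ + 1)), by positivity, ?_⟩
  intro X _ μ _ a S m E z hz hzR hzΦ
  obtain ⟨x₀⟩ : Nonempty X := nonempty_of_isProbabilityMeasure μ
  have : Nonempty X := ⟨x₀⟩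
  have hmΦ : ∀ x, ‖m z x‖ ≤ Φ := fun x => (BB.norm_apply_le _ x).trans hzΦ
  have hzΛ : ‖BB.toL2 μ (m z)‖ ≤ Φ := (BB.norm_toL2_le_norm μ _).trans hzΦ
  have him : z.im ≤ R := ((le_abs_self _).trans (Complex.abs_im_le_norm z)).trans hzR
  have hcm := E.le_norm hz hzR hK hzΛ
  have D := E.solutionBounds hz hc0 hcm hzΛ (E.le_tau_of_bounded hz hK hc0 hcm hmΦ)
  have hcont : ∀ᶠ z' in nhds z, ‖m z'‖ < Φ + 1 :=
    (E.sol.continuousAt E.real E.sp hz).norm.eventually_lt continuousAt_const (by linarith)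
  filter_upwards [E.eventually_linearised hz hzΛ, hcont] with z' ⟨hz', w, g, hw, hΔ, hg⟩ hΦ'
  have hpow := rpow_root_pow hz 3 (by norm_num)
  set y := z.im ^ (1 / (3 : ℕ) : ℝ) with hy
  have hy0 : 0 < y := by positivity
  have key := h (SolutionBounds.dens μ (m z)) y ‖BB.toL2 μ w‖ ‖BB.toL2 μ g‖ D.dens_pos hy0
    (norm_nonneg _) D.dens_le_Lam
    (by rw [hpow]; exact D.norm_le_of_eta hw)
    (by
      have hβ : 4 * L * (T * SolutionBounds.dens μ (m z)) / (c ^ (2 * (L - 1)) * ρ) =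
        4 * L * T / (c ^ (2 * (L - 1)) * ρ) * SolutionBounds.dens μ (m z) := by ring
      rw [hpow, ← hβ]
      exact D.norm_le_of_dens hw)
  have hN : ‖BB.toL2 μ (m z - m z')‖ ≤ Φ * (C / y ^ 2 * ((Φ + 1) * ‖z - z'‖)) := by
    refine (BB.norm_toL2_le μ hΦ.le (w := w) fun x => ?_).trans ?_
    · rw [show (m z - m z') x = (‖m z x‖ : ℂ) * w x from hΔ x, norm_mul, Complex.norm_real,
        norm_norm]
      exact mul_le_mul_of_nonneg_right (hmΦ x) (norm_nonneg _)
    · exact mul_le_mul_of_nonneg_left (key.trans (by gcongr)) hΦ.le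
  -- Im z ≤ R lets the direct term |z - z'| be absorbed into the singular factor (Im z)^(-2/3).
  have hyY : 1 ≤ Y ^ 2 / y ^ 2 := by
    rw [one_le_div (by positivity)]
    exact pow_le_pow_left₀ hy0.le (Real.rpow_le_rpow hz.le him (by positivity)) 2
  have hζ : ‖z - z'‖ ≤ Y ^ 2 / y ^ 2 * ‖z - z'‖ := le_mul_of_one_le_left (norm_nonneg _) hyY
  refine BB.norm_le (by positivity) fun x => ?_
  rw [E.sol.sub_eq hz hz', norm_mul, norm_mul]
  -- From L² to the supremum norm: in Δ = m m' (z - z' + S Δ) the operator S needs only the L²-norm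
  -- of Δ.
  have h1 : ‖z - z' + S (m z - m z') x‖ ≤
      Y ^ 2 / y ^ 2 * ‖z - z'‖ + K * (Φ * (C / y ^ 2 * ((Φ + 1) * ‖z - z'‖))) :=
    (norm_add_le _ _).trans (add_le_add hζ ((E.smoothing _ x).trans
      (mul_le_mul_of_nonneg_left hN hK)))
  have h2 : ‖m z x‖ * ‖m z' x‖ ≤ Φ * (Φ + 1) :=
    mul_le_mul (hmΦ x) ((BB.norm_apply_le _ x).trans hΦ'.le) (norm_nonneg _) hΦ.le
  refine (mul_le_mul h2 h1 (norm_nonneg _) (by positivity)).trans (le_of_eq ?_)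
  have h3 := div_rpow_root_pow hz 1 3 2
  push_cast at h3
  rw [one_mul] at h3
  rw [← h3, hy]
  push_cast
  ring

/-! ### Spectral parameters with |z| ≥ 2Σ -/

namespace Setting

variable {μ : Measure X} [IsProbabilityMeasure μ] {a : BB X} {S : BB X →L[ℂ] BB X}
  {m : ℂ → BB X} {A K ρ : ℝ} {L : ℕ}

/-- Testing primitivity on the constant 1 gives ρ ≤ ‖S‖^L, and ‖S‖^L ≤ ‖S‖ when ‖S‖ < 1. A lower
bound on ‖S‖ is needed because the smallness of m below is relative to ‖S‖^(-1/2). -/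
theorem min_le_opNorm (E : Setting μ a S m A K ρ L) : min 1 ρ ≤ ‖S‖ := by
  have hS0 : 0 ≤ ‖S‖ := S.opNorm_nonneg
  obtain ⟨x⟩ : Nonempty X := nonempty_of_isProbabilityMeasure μ
  have hpow : ∀ n : ℕ, ‖(S ^ n) (BB.const 1)‖ ≤ ‖S‖ ^ n := fun n => by
    induction n with
    | zero => exact BB.norm_le (by simp) fun y => by simp
    | succ n ih =>
      have h1 : (S ^ (n + 1)) (BB.const 1) = S ((S ^ n) (BB.const 1)) := by rw [pow_succ']; rfl
      rw [h1, pow_succ']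
      exact (S.le_opNorm _).trans (mul_le_mul_of_nonneg_left ih hS0)
  have h1 := (Complex.le_def.1 (E.primitive.le_pow (BB.const 1) (fun y => by simp) x)).1
  have h2 : ρ ≤ ‖S‖ ^ L := by
    refine le_trans ?_ ((Complex.re_le_norm _).trans ((BB.norm_apply_le _ x).trans (hpow L)))
    refine le_trans (le_of_eq ?_) h1
    simp [avg]
  by_contra! h3
  obtain ⟨h4, h5⟩ := lt_min_iff.1 h3
  have h6 : ‖S‖ ^ L ≤ ‖S‖ := pow_le_of_le_one hS0 h4.le (by have := E.primitive.one_le; omega)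
  linarith

theorem opNorm_le (E : Setting μ a S m A K ρ L) (hK : 0 ≤ K) : ‖S‖ ≤ K :=
  S.opNorm_le_bound hK fun u => BB.norm_le (by positivity) fun x =>
    (E.smoothing u x).trans (mul_le_mul_of_nonneg_left (BB.norm_toL2_le_norm μ u) hK)

theorem opNorm_pos (E : Setting μ a S m A K ρ L) : 0 < ‖S‖ :=
  (lt_min one_pos E.primitive.pos).trans_le E.min_le_opNorm

theorem norm_mul_le_one (E : Setting μ a S m A K ρ L) {z : ℂ} (hz : 0 < z.im) (x : X) :
    ‖m z x‖ * (‖z‖ - ‖a‖ - ‖S‖ * ‖m z‖) ≤ 1 := by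
  have h1 := congrArg norm (E.sol.mul_eq hz x)
  rw [norm_mul, norm_neg, norm_one] at h1
  rw [← h1]
  refine mul_le_mul_of_nonneg_left ?_ (norm_nonneg _)
  have h2 := norm_apply_le_opNorm S (m z) x
  have h3 := BB.norm_apply_le a x
  have h4 : ‖z‖ ≤ ‖z + a x + S (m z) x‖ + ‖S (m z) x‖ + ‖a x‖ := by
    have : z = (z + a x + S (m z) x) - S (m z) x - a x := by ring
    conv_lhs => rw [this]
    exact (norm_sub_le _ _).trans (add_le_add_left (norm_sub_le _ _) _)
  linarith

theorem norm_le_of_lt (E : Setting μ a S m A K ρ L) {z : ℂ} (hz : 0 < z.im) {d : ℝ} (hd : 0 < d)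
    (hdz : d = ‖z‖ - ‖a‖) (h : 2 * (‖S‖ * ‖m z‖) ≤ d) : ‖m z‖ ≤ 2 / d := by
  refine BB.norm_le (by positivity) fun x => ?_
  have h1 := E.norm_mul_le_one hz x
  rw [← hdz] at h1
  rw [le_div_iff₀ hd]
  have h2 : ‖m z x‖ * (d / 2) ≤ ‖m z x‖ * (d - ‖S‖ * ‖m z‖) :=
    mul_le_mul_of_nonneg_left (by linarith) (norm_nonneg _)
  linarith

theorem norm_le_norm_add (z : ℂ) (hz : 0 < z.im) {t : ℝ} (ht : 0 ≤ t) :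
    ‖z‖ ≤ ‖z + t * Complex.I‖ := by
  rw [Complex.norm_eq_sqrt_sq_add_sq, Complex.norm_eq_sqrt_sq_add_sq]
  refine Real.sqrt_le_sqrt ?_
  simp
  nlinarith

/-- Outside the disc of radius `2 Σ` the solution is small. -/
theorem norm_le_of_two_mul_Sig_le (E : Setting μ a S m A K ρ L) {z : ℂ} (hz : 0 < z.im)
    (h : 2 * Sig a S ≤ ‖z‖) : 2 * (Real.sqrt ‖S‖ * ‖m z‖) ≤ 1 := by
  have hS := E.opNorm_pos
  set q := Real.sqrt ‖S‖ with hq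
  have hq0 : 0 < q := Real.sqrt_pos.2 hS
  have hq2 : q ^ 2 = ‖S‖ := Real.sq_sqrt hS.le
  have ha0 := norm_nonneg a
  have hd : ∀ t : ℝ, 0 ≤ t → 4 * q ≤ ‖z + t * Complex.I‖ - ‖a‖ := fun t ht => by
    have := norm_le_norm_add z hz ht
    rw [Sig, ← hq] at h
    linarith
  have him : ∀ t : ℝ, 0 ≤ t → 0 < (z + t * Complex.I).im := fun t ht => by simp; linarith
  -- the forbidden value
  have hne : ∀ t : ℝ, 0 ≤ t →
      ‖z + t * Complex.I‖ - ‖a‖ - 2 * (‖S‖ * ‖m (z + t * Complex.I)‖) ≠ 0 := fun t ht h0 => by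
    have hdt := hd t ht
    have h1 := E.norm_le_of_lt (him t ht) (d := ‖z + t * Complex.I‖ - ‖a‖) (by linarith) rfl
      (by linarith)
    -- With d = |z + it| - ‖a‖, equality 2‖S‖‖m‖ = d together with ‖m‖ ≤ 2/d would force d² ≤ 4q²,
    -- against d ≥ 4q.
    rw [le_div_iff₀ (by linarith)] at h1
    nlinarith [mul_le_mul hdt hdt (by positivity) (by linarith)]
  have hcont : ContinuousOn (fun t : ℝ =>
      ‖z + t * Complex.I‖ - ‖a‖ - 2 * (‖S‖ * ‖m (z + t * Complex.I)‖)) (Set.Icc 0 q) := by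
    intro t ht
    have h1 : ContinuousAt (fun t : ℝ => z + t * Complex.I) t := by fun_prop
    have h2 : ContinuousAt (fun t : ℝ => m (z + t * Complex.I)) t :=
      ContinuousAt.comp (f := fun t : ℝ => z + t * Complex.I) (g := m)
        (E.sol.continuousAt E.real E.sp (him t ht.1)) h1
    exact (((h1.norm.sub continuousAt_const).sub
      (continuousAt_const.mul (continuousAt_const.mul h2.norm)))).continuousWithinAt
  -- At height at least q the trivial bound 1/Im gives 2‖S‖‖m‖ ≤ 2q. As the value zero is excluded
  -- along the segment, the sign persists down to z.
  have hend : 0 < ‖z + q * Complex.I‖ - ‖a‖ - 2 * (‖S‖ * ‖m (z + q * Complex.I)‖) := by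
    have h1 := hd q hq0.le
    have h2 := E.sol.norm_le E.real E.sp (him q hq0.le)
    have h3 : (z + q * Complex.I).im = z.im + q := by simp
    rw [h3, le_div_iff₀ (by linarith)] at h2
    have h4 : ‖m (z + q * Complex.I)‖ * q ≤ 1 := by
      nlinarith [norm_nonneg (m (z + q * Complex.I))]
    have h5 : ‖S‖ * ‖m (z + q * Complex.I)‖ ≤ q := by rw [← hq2]; nlinarith
    linarith
  have hstart : 0 < ‖z‖ - ‖a‖ - 2 * (‖S‖ * ‖m z‖) := by
    by_contra! hcon
    obtain ⟨t, ht, ht0⟩ := intermediate_value_Icc hq0.le hcont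
      (show (0 : ℝ) ∈ Set.Icc _ _ from ⟨by simpa using hcon, hend.le⟩)
    exact hne t ht.1 ht0
  have h0 := hd 0 le_rfl
  simp only [Complex.ofReal_zero, zero_mul, add_zero] at h0
  have h1 := E.norm_le_of_lt hz (d := ‖z‖ - ‖a‖) (by linarith) rfl (by linarith)
  have h2 : 2 / (‖z‖ - ‖a‖) ≤ 2 / (4 * q) := by gcongr
  have h3 : q * (2 / (4 * q)) = 1 / 2 := by field_simp; norm_num
  have h4 := mul_le_mul_of_nonneg_left (h1.trans h2) hq0.le
  linarith

/-- Here ‖S‖‖m‖‖m'‖ ≤ 1/2 for z' near z, so the term S Δ in Δ = m m' (z - z' + S Δ) is absorbed and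
‖S‖‖Δ‖ ≤ |z - z'|. -/
theorem eventually_of_two_mul_Sig_le (E : Setting μ a S m A K ρ L) {z : ℂ} (hz : 0 < z.im)
    (h : 2 * Sig a S ≤ ‖z‖) :
    ∀ᶠ z' in nhds z, ‖m z - m z'‖ ≤ 1 / min 1 ρ * ‖z - z'‖ := by
  have hS := E.opNorm_pos
  have hmin := E.min_le_opNorm
  have hmin0 : 0 < min 1 ρ := lt_min one_pos E.primitive.pos
  have h1 := E.norm_le_of_two_mul_Sig_le hz h
  set q := Real.sqrt ‖S‖ with hq
  have hq0 : 0 < q := Real.sqrt_pos.2 hS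
  have hq2 : q ^ 2 = ‖S‖ := Real.sq_sqrt hS.le
  have hcont' : ContinuousAt (fun z' => q * ‖m z'‖) z :=
    continuousAt_const.mul (E.sol.continuousAt E.real E.sp hz).norm
  have hcont : ∀ᶠ z' in nhds z, q * ‖m z'‖ < 1 :=
    hcont'.eventually_lt continuousAt_const (by linarith)
  have him : ∀ᶠ z' in nhds z, 0 < z'.im :=
    (isOpen_lt continuous_const Complex.continuous_im).mem_nhds hz
  filter_upwards [hcont, him] with z' h2 hz'
  have h3 : q ^ 2 * (‖m z‖ * ‖m z'‖) ≤ 1 / 2 := by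
    have := mul_le_mul (by linarith : q * ‖m z‖ ≤ 1 / 2) h2.le (by positivity) (by norm_num)
    linarith
  have h4 : ‖m z - m z'‖ ≤ ‖m z‖ * ‖m z'‖ * (‖z - z'‖ + q ^ 2 * ‖m z - m z'‖) := by
    refine BB.norm_le (by positivity) fun x => ?_
    rw [E.sol.sub_eq hz hz', norm_mul, norm_mul, hq2]
    have h5 := norm_apply_le_opNorm S (m z - m z') x
    have h6 : ‖z - z' + S (m z - m z') x‖ ≤ ‖z - z'‖ + ‖S‖ * ‖m z - m z'‖ :=
      (norm_add_le _ _).trans (by linarith)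
    have h7 := BB.norm_apply_le (m z) x
    have h8 := BB.norm_apply_le (m z') x
    gcongr
  rw [div_mul_eq_mul_div, one_mul, le_div_iff₀ hmin0]
  have h5 : ‖m z - m z'‖ * min 1 ρ ≤ ‖m z - m z'‖ * q ^ 2 := by rw [hq2]; gcongr
  have h6 := mul_le_mul_of_nonneg_right h3 (norm_nonneg (z - z'))
  have h7 := mul_le_mul_of_nonneg_right h3
    (mul_nonneg (sq_nonneg q) (norm_nonneg (m z - m z')))
  have h8 := mul_le_mul_of_nonneg_left h4 (sq_nonneg q)
  nlinarith

end Setting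

/-! ### From local Lipschitz bounds to Hölder continuity and extension -/

section Holder

variable {E : Type*} [NormedAddCommGroup E] {f : ℂ → E}

/-- Integration of a local Lipschitz bound along a segment. -/
theorem norm_sub_le_of_local {p u : ℂ} {b : ℝ} {κ B : ℝ → ℝ} (hb : 0 ≤ b)
    (hloc : ∀ t ∈ Set.Icc 0 b, ∀ᶠ z in nhds (p + t * u),
      ‖f (p + t * u) - f z‖ ≤ κ t * ‖p + t * u - z‖)
    (hB : ∀ t ∈ Set.Icc 0 b, HasDerivAt B (κ t * ‖u‖) t) (hB0 : 0 ≤ B 0) :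
    ‖f (p + b * u) - f p‖ ≤ B b := by
  have hγ : ∀ t : ℝ, ContinuousAt (fun s : ℝ => p + s * u) t := fun t => by fun_prop
  have hloc' : ∀ t ∈ Set.Icc 0 b, ∀ᶠ s : ℝ in nhds t,
      ‖f (p + t * u) - f (p + s * u)‖ ≤ κ t * ‖u‖ * |s - t| := fun t ht => by
    filter_upwards [(hγ t).eventually (hloc t ht)] with s hs
    refine hs.trans (le_of_eq ?_)
    have : p + (t : ℂ) * u - (p + s * u) = ((t - s : ℝ) : ℂ) * u := by push_cast; ring
    rw [this, norm_mul, Complex.norm_real, Real.norm_eq_abs, abs_sub_comm]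
    ring
  have hcont : ∀ t ∈ Set.Icc 0 b, ContinuousAt (fun s : ℝ => f (p + s * u)) t := fun t ht => by
    rw [ContinuousAt, tendsto_iff_norm_sub_tendsto_zero]
    have h1 : Filter.Tendsto (fun s : ℝ => κ t * ‖u‖ * |s - t|) (nhds t) (nhds 0) := by
      have : ContinuousAt (fun s : ℝ => κ t * ‖u‖ * |s - t|) t := by fun_prop
      simpa [ContinuousAt] using this
    refine squeeze_zero' (Filter.Eventually.of_forall fun _ => norm_nonneg _) ?_ h1
    filter_upwards [hloc' t ht] with s hs
    rwa [norm_sub_rev]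
  -- A bound on the right slopes suffices, so f need not be differentiable along the segment.
  have key := image_le_of_liminf_slope_right_le_deriv_boundary (a := 0) (b := b)
    (f := fun t : ℝ => ‖f (p + t * u) - f p‖) (B := B) (B' := fun t => κ t * ‖u‖)
    (fun t ht => ((hcont t ht).sub continuousAt_const).norm.continuousWithinAt)
    (by simpa using hB0) (fun t ht => (hB t ht).continuousAt.continuousWithinAt)
    (fun t ht => (hB t ⟨ht.1, ht.2.le⟩).hasDerivWithinAt)
    (fun t ht r hr => by
      refine Filter.Eventually.frequently ?_
      have h1 := (hloc' t ⟨ht.1, ht.2.le⟩).filter_mono (nhdsWithin_le_nhds (s := Set.Ioi t))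
      filter_upwards [h1, self_mem_nhdsWithin] with s hs hst
      have hst' : 0 < s - t := sub_pos.2 hst
      rw [slope_def_field, div_lt_iff₀ hst']
      rw [abs_of_pos hst'] at hs
      have h2 := norm_sub_norm_le (f (p + s * u) - f p) (f (p + t * u) - f p)
      rw [sub_sub_sub_cancel_right, norm_sub_rev (f (p + s * u)) (f (p + t * u))] at h2
      have h3 := mul_lt_mul_of_pos_right hr hst'
      linarith)
  exact key ⟨hb, le_rfl⟩

/-- The singular factor is integrable in the height, and subadditivity of r ↦ r^(1-θ) removes the
dependence on Im z from the integral. -/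
theorem norm_sub_le_vertical {z : ℂ} {C θ ℓ : ℝ} (hz : 0 < z.im) (hC : 0 ≤ C) (hθ0 : 0 ≤ θ)
    (hθ : θ < 1) (hℓ : 0 ≤ ℓ)
    (hloc : ∀ t ∈ Set.Icc 0 ℓ, ∀ᶠ w in nhds (z + t * Complex.I),
      ‖f (z + t * Complex.I) - f w‖ ≤
        C * (1 + (z.im + t) ^ (-θ)) * ‖z + t * Complex.I - w‖) :
    ‖f (z + ℓ * Complex.I) - f z‖ ≤ C * (ℓ + ℓ ^ (1 - θ) / (1 - θ)) := by
  have hθ' : 0 < 1 - θ := by linarith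
  have h := norm_sub_le_of_local (f := f) (p := z) (u := Complex.I) (b := ℓ)
    (κ := fun t => C * (1 + (z.im + t) ^ (-θ)))
    (B := fun t => C * (t + ((z.im + t) ^ (1 - θ) - z.im ^ (1 - θ)) / (1 - θ))) hℓ hloc
    (fun t ht => by
      have hpos : 0 < z.im + t := by linarith [ht.1]
      have h1 : HasDerivAt (fun t : ℝ => z.im + t) 1 t := (hasDerivAt_id t).const_add _
      have h2 := h1.rpow_const (p := 1 - θ) (Or.inl hpos.ne')
      have h3 := (((hasDerivAt_id t).add
        ((h2.sub_const (z.im ^ (1 - θ))).div_const (1 - θ)))).const_mul C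
      refine h3.congr_deriv ?_
      rw [Complex.norm_I, show 1 - θ - 1 = -θ by ring]
      field_simp)
    (by simp)
  refine h.trans (mul_le_mul_of_nonneg_left (add_le_add_right ?_ _) hC)
  refine div_le_div_of_nonneg_right ?_ hθ'.le
  have := Real.rpow_add_le_add_rpow hz.le hℓ hθ'.le (by linarith)
  linarith

theorem norm_sub_le_horizontal {p u : ℂ} {κ : ℝ}
    (hloc : ∀ t ∈ Set.Icc (0 : ℝ) 1, ∀ᶠ w in nhds (p + t * u),
      ‖f (p + t * u) - f w‖ ≤ κ * ‖p + t * u - w‖) :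
    ‖f (p + u) - f p‖ ≤ κ * ‖u‖ := by
  have h := norm_sub_le_of_local (f := f) (p := p) (u := u) (b := 1)
    (κ := fun _ => κ) (B := fun t => κ * ‖u‖ * t) zero_le_one hloc
    (fun t _ => by simpa using (hasDerivAt_id t).const_mul (κ * ‖u‖)) (by simp)
  simpa using h

theorem norm_sub_real_le {z : ℂ} (hz : 0 ≤ z.im) (τ : ℝ) {t : ℝ} (ht : 0 ≤ t) :
    ‖z - τ‖ ≤ ‖z + t * Complex.I - τ‖ := by
  rw [Complex.norm_eq_sqrt_sq_add_sq, Complex.norm_eq_sqrt_sq_add_sq]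
  refine Real.sqrt_le_sqrt ?_
  simp
  nlinarith

theorem domain_add {s ε : ℝ} {I : Set ℝ} {z : ℂ} (hz : z ∈ domain s I ε) {t : ℝ} (ht : 0 ≤ t) :
    z + t * Complex.I ∈ domain s I ε :=
  ⟨by have := hz.1; simp; linarith,
    fun τ hτ => (hz.2 τ hτ).trans (norm_sub_real_le hz.1.le τ ht)⟩

theorem domain_mono {s ε ε' : ℝ} {I : Set ℝ} (h : ε' ≤ ε) : domain s I ε ⊆ domain s I ε' :=
  fun _ hz => ⟨hz.1, fun τ hτ => h.trans (hz.2 τ hτ)⟩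

/-- A Hardy-Littlewood type argument: a local Lipschitz bound that blows up like `(Im z) ^ (-θ)`
implies Hölder continuity with exponent `1 - θ`. -/
theorem holder_of_local {s ε θ C M : ℝ} {I : Set ℝ} (hε : 0 < ε) (hC : 0 ≤ C)
    (hM : 0 ≤ M) (hθ0 : 0 ≤ θ) (hθ : θ < 1)
    (hloc : ∀ z ∈ domain s I (ε / 2), ∀ᶠ w in nhds z,
      ‖f z - f w‖ ≤ C * (1 + z.im ^ (-θ)) * ‖z - w‖)
    (hbound : ∀ z ∈ domain s I ε, ‖f z‖ ≤ M) {z₁ z₂ : ℂ} (h₁ : z₁ ∈ domain s I ε)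
    (h₂ : z₂ ∈ domain s I ε) :
    ‖f z₁ - f z₂‖ ≤ (C * (3 * (ε / 2) ^ θ + 1 + 2 / (1 - θ)) + 2 * M / (ε / 2) ^ (1 - θ)) *
      ‖z₁ - z₂‖ ^ (1 - θ) := by
  have hθ' : 0 < 1 - θ := by linarith
  set ℓ := ‖z₁ - z₂‖ with hℓ
  have hℓ0 : 0 ≤ ℓ := norm_nonneg _
  -- For distant points the bound M on f suffices. Near points are joined by rising ℓ = |z₁ - z₂|,
  -- crossing, and descending.
  rcases lt_or_ge (ε / 2) ℓ with hfar | hnear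
  · have h3 : ‖f z₁ - f z₂‖ ≤ 2 * M := by
      refine (norm_sub_le _ _).trans ?_
      linarith [hbound _ h₁, hbound _ h₂]
    have h4 : (ε / 2) ^ (1 - θ) ≤ ℓ ^ (1 - θ) := Real.rpow_le_rpow (by positivity) hfar.le hθ'.le
    have h5 : 2 * M ≤ 2 * M / (ε / 2) ^ (1 - θ) * ℓ ^ (1 - θ) := by
      rw [div_mul_eq_mul_div, le_div_iff₀ (by positivity)]
      gcongr
    have h6 : 0 ≤ C * (3 * (ε / 2) ^ θ + 1 + 2 / (1 - θ)) * ℓ ^ (1 - θ) := by positivity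
    rw [add_mul]
    linarith
  rcases hℓ0.eq_or_lt with h0 | hpos
  · have : z₁ = z₂ := sub_eq_zero.1 (norm_eq_zero.1 h0.symm)
    rw [this, sub_self, norm_zero]
    positivity
  have hvert : ∀ z ∈ domain s I ε, ‖f (z + ℓ * Complex.I) - f z‖ ≤
      C * (ℓ + ℓ ^ (1 - θ) / (1 - θ)) := fun z hz =>
    norm_sub_le_vertical hz.1 hC hθ0 hθ hℓ0 fun t ht => by
      have h := hloc _ (domain_add (domain_mono (by linarith) hz) ht.1)
      have him : (z + t * Complex.I).im = z.im + t := by simp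
      rwa [him] at h
  have hhor : ‖f (z₁ + ℓ * Complex.I + (z₂ - z₁)) - f (z₁ + ℓ * Complex.I)‖ ≤
      C * (1 + ℓ ^ (-θ)) * ‖z₂ - z₁‖ := by
    refine norm_sub_le_horizontal fun t ht => ?_
    have him : (z₁ + ℓ * Complex.I + t * (z₂ - z₁)).im = (1 - t) * z₁.im + t * z₂.im + ℓ := by
      simp; ring
    have him' : ℓ ≤ (z₁ + ℓ * Complex.I + t * (z₂ - z₁)).im := by
      rw [him]
      have := mul_nonneg (sub_nonneg.2 ht.2) h₁.1.le
      have := mul_nonneg ht.1 h₂.1.le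
      linarith
    -- The domain need not be convex. The crossing moves by at most ℓ ≤ ε/2, which costs half of the
    -- distance; hence the local bound is assumed on the larger domain.
    have hmem : z₁ + ℓ * Complex.I + t * (z₂ - z₁) ∈ domain s I (ε / 2) := by
      refine ⟨hpos.trans_le him', fun τ hτ => ?_⟩
      have h3 := (domain_add h₁ hℓ0).2 τ hτ
      have h4 : ‖(t : ℂ) * (z₂ - z₁)‖ ≤ ℓ := by
        rw [norm_mul, Complex.norm_real, Real.norm_eq_abs, abs_of_nonneg ht.1, norm_sub_rev]
        exact mul_le_of_le_one_left hℓ0 ht.2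
      have h5 : ‖z₁ + ℓ * Complex.I - τ‖ ≤
          ‖z₁ + ℓ * Complex.I + t * (z₂ - z₁) - τ‖ + ‖(t : ℂ) * (z₂ - z₁)‖ := by
        have : z₁ + ℓ * Complex.I - τ =
          (z₁ + ℓ * Complex.I + t * (z₂ - z₁) - τ) - t * (z₂ - z₁) := by ring
        rw [this]
        exact norm_sub_le _ _
      linarith
    filter_upwards [hloc _ hmem] with w hw
    refine hw.trans ?_
    have h6 : (z₁ + ℓ * Complex.I + t * (z₂ - z₁)).im ^ (-θ) ≤ ℓ ^ (-θ) :=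
      Real.rpow_le_rpow_of_nonpos hpos him' (by linarith)
    gcongr
  rw [norm_sub_rev z₂ z₁, ← hℓ, show z₁ + ℓ * Complex.I + (z₂ - z₁) = z₂ + ℓ * Complex.I by ring]
    at hhor
  have h1 := hvert z₁ h₁
  have h2 := hvert z₂ h₂
  have hsum : ‖f z₁ - f z₂‖ ≤ 2 * (C * (ℓ + ℓ ^ (1 - θ) / (1 - θ))) +
      C * (1 + ℓ ^ (-θ)) * ℓ := by
    have : f z₁ - f z₂ = -(f (z₁ + ℓ * Complex.I) - f z₁) -
      (f (z₂ + ℓ * Complex.I) - f (z₁ + ℓ * Complex.I)) + (f (z₂ + ℓ * Complex.I) - f z₂) := by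
      abel
    rw [this]
    refine (norm_add_le _ _).trans ?_
    have h3 := norm_sub_le (-(f (z₁ + ℓ * Complex.I) - f z₁))
      (f (z₂ + ℓ * Complex.I) - f (z₁ + ℓ * Complex.I))
    rw [norm_neg] at h3
    linarith
  have hℓ1 : ℓ ^ (-θ) * ℓ = ℓ ^ (1 - θ) := by
    conv_lhs => rw [← Real.rpow_one ℓ, ← Real.rpow_mul hℓ0, one_mul, ← Real.rpow_add hpos]
    congr 1; ring
  have hℓ2 : ℓ ≤ (ε / 2) ^ θ * ℓ ^ (1 - θ) := by
    have h3 : ℓ ^ θ ≤ (ε / 2) ^ θ := Real.rpow_le_rpow hℓ0 hnear hθ0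
    have h4 : ℓ ^ θ * ℓ ^ (1 - θ) = ℓ := by
      rw [← Real.rpow_add hpos, add_sub_cancel, Real.rpow_one]
    calc ℓ = ℓ ^ θ * ℓ ^ (1 - θ) := h4.symm
      _ ≤ _ := by gcongr
  have h7 : 0 ≤ 2 * M / (ε / 2) ^ (1 - θ) * ℓ ^ (1 - θ) := by positivity
  have h8 : 2 * (C * (ℓ + ℓ ^ (1 - θ) / (1 - θ))) + C * (1 + ℓ ^ (-θ)) * ℓ =
      C * (3 * ℓ + (1 + 2 / (1 - θ)) * ℓ ^ (1 - θ)) := by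
    have : C * (1 + ℓ ^ (-θ)) * ℓ = C * (ℓ + ℓ ^ (-θ) * ℓ) := by ring
    rw [this, hℓ1]
    field_simp
    ring
  rw [h8] at hsum
  have h9 : C * (3 * ℓ + (1 + 2 / (1 - θ)) * ℓ ^ (1 - θ)) ≤
      C * (3 * ((ε / 2) ^ θ * ℓ ^ (1 - θ)) + (1 + 2 / (1 - θ)) * ℓ ^ (1 - θ)) := by gcongr
  rw [add_mul]
  linarith

/-- Extension of a Hölder continuous function to the closed domain. -/
theorem exists_extension [CompleteSpace E] {s ε C α : ℝ} {I : Set ℝ} (hα : 0 < α)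
    (h : ∀ z₁ ∈ domain s I ε, ∀ z₂ ∈ domain s I ε, ‖f z₁ - f z₂‖ ≤ C * ‖z₁ - z₂‖ ^ α) :
    ∃ F : ℂ → E, (∀ z ∈ domain s I ε, F z = f z) ∧ ContinuousOn F (closedDomain s I ε) ∧
      ∀ z₁ ∈ closedDomain s I ε, ∀ z₂ ∈ closedDomain s I ε,
        ‖F z₁ - F z₂‖ ≤ C * ‖z₁ - z₂‖ ^ α := by
  have hzero : Filter.Tendsto (fun r : ℝ => C * r ^ α) (nhds 0) (nhds 0) := by
    have : ContinuousAt (fun r : ℝ => C * r ^ α) 0 :=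
      continuousAt_const.mul (Real.continuousAt_rpow_const _ _ (Or.inr hα.le))
    simpa [ContinuousAt, Real.zero_rpow hα.ne'] using this
  set g : ℂ → ℕ → ℂ := fun z n => z + ((1 / ((n : ℝ) + 1) : ℝ) : ℂ) * Complex.I with hg
  have hgt : ∀ z, Filter.Tendsto (g z) Filter.atTop (nhds z) := fun z => by
    have h1 : Filter.Tendsto (fun n : ℕ => ((1 / ((n : ℝ) + 1) : ℝ) : ℂ)) Filter.atTop (nhds 0) := by
      have := (Complex.continuous_ofReal.tendsto 0).comp
        (tendsto_one_div_add_atTop_nhds_zero_nat (𝕜 := ℝ))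
      rw [Complex.ofReal_zero] at this
      exact this
    simpa [hg] using (h1.mul_const Complex.I).const_add z
  have hgmem : ∀ z ∈ closedDomain s I ε, ∀ n, g z n ∈ domain s I ε := fun z hz n => by
    have hn : (0 : ℝ) < 1 / ((n : ℝ) + 1) := by positivity
    refine ⟨?_, fun τ hτ => (hz.2 τ hτ).trans (norm_sub_real_le hz.1 τ hn.le)⟩
    have := hz.1
    simp only [hg, Complex.add_im, Complex.im_ofReal_mul, Complex.I_im]
    linarith
  have hcauchy : ∀ z ∈ closedDomain s I ε, ∃ l, Filter.Tendsto (fun n => f (g z n)) Filter.atTop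
      (nhds l) := fun z hz => by
    refine cauchySeq_tendsto_of_complete ?_
    rw [cauchySeq_iff_tendsto_dist_atTop_0]
    have hc := (cauchySeq_iff_tendsto_dist_atTop_0.1 (hgt z).cauchySeq)
    refine squeeze_zero (fun _ => dist_nonneg) (fun n => ?_) (hzero.comp hc)
    rw [dist_eq_norm, Function.comp_apply, dist_eq_norm]
    exact h _ (hgmem z hz _) _ (hgmem z hz _)
  choose! F hF using hcauchy
  have hsub : ∀ z, z ∈ domain s I ε → z ∈ closedDomain s I ε := fun z hz => ⟨hz.1.le, hz.2⟩
  have hholder : ∀ z₁ ∈ closedDomain s I ε, ∀ z₂ ∈ closedDomain s I ε,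
      ‖F z₁ - F z₂‖ ≤ C * ‖z₁ - z₂‖ ^ α := fun z₁ h₁ z₂ h₂ => by
    refine le_of_tendsto ((hF z₁ h₁).sub (hF z₂ h₂)).norm (Filter.Eventually.of_forall fun n => ?_)
    have := h _ (hgmem z₁ h₁ n) _ (hgmem z₂ h₂ n)
    -- Both points are approached by the same vertical shift, so the limit keeps the constant C.
    have h3 : g z₁ n - g z₂ n = z₁ - z₂ := by simp [hg]
    rwa [h3] at this
  have hcontF : ∀ (G : ℂ → E) (D : Set ℂ), (∀ z₁ ∈ D, ∀ z₂ ∈ D,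
      ‖G z₁ - G z₂‖ ≤ C * ‖z₁ - z₂‖ ^ α) → ContinuousOn G D := fun G D hD z hz => by
    rw [ContinuousWithinAt, tendsto_iff_norm_sub_tendsto_zero]
    have h1 : Filter.Tendsto (fun w : ℂ => ‖w - z‖) (nhdsWithin z D) (nhds 0) := by
      have : ContinuousAt (fun w : ℂ => ‖w - z‖) z := by fun_prop
      have h2 : Filter.Tendsto (fun w : ℂ => ‖w - z‖) (nhds z) (nhds 0) := by
        simpa [ContinuousAt] using this
      exact h2.mono_left nhdsWithin_le_nhds
    refine squeeze_zero' (Filter.Eventually.of_forall fun _ => norm_nonneg _) ?_ (hzero.comp h1)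
    filter_upwards [self_mem_nhdsWithin] with w hw
    exact hD w hw z hz
  refine ⟨F, fun z hz => ?_, hcontF F _ hholder, hholder⟩
  refine tendsto_nhds_unique (hF z (hsub z hz)) ?_
  have h1 := hcontF f _ h z hz
  exact h1.tendsto.comp (tendsto_nhdsWithin_iff.2
    ⟨hgt z, Filter.Eventually.of_forall fun n => hgmem z (hsub z hz) n⟩)

end Holder

/-! ### Gluing the regions of the domain -/

theorem SmoothingWith.norm_apply_le {μ : Measure X} [IsProbabilityMeasure μ]
    {S : BB X →L[ℂ] BB X} {K : ℝ} (h : SmoothingWith μ S K) (u : BB X) (x : X) :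
    ‖S u x‖ ≤ K * ‖BB.toL2 μ u‖ := by
  obtain ⟨T, k, hT, hK, -⟩ := h
  rw [← hT]
  exact (BB.norm_apply_le _ x).trans ((T.le_opNorm _).trans (by gcongr))

theorem SmoothingWith.nonneg {μ : Measure X} [IsProbabilityMeasure μ]
    {S : BB X →L[ℂ] BB X} {K : ℝ} (h : SmoothingWith μ S K) : 0 ≤ K := by
  obtain ⟨T, k, hT, hK, -⟩ := h
  exact T.opNorm_nonneg.trans hK

/-- The Hölder constant that results from a local bound with constant `C` and a bound `Q` on the
size. -/
def holderConst (C Q ρ ε θ : ℝ) : ℝ :=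
  (C + 1 / min 1 ρ) * (3 * (ε / 2) ^ θ + 1 + 2 / (1 - θ)) +
    2 * (Q + 1 / Real.sqrt (min 1 ρ)) / (ε / 2) ^ (1 - θ)

theorem holderConst_pos {C Q ρ ε θ : ℝ} (hC : 0 < C) (hQ : 0 < Q) (hρ : 0 < ρ) (hε : 0 < ε)
    (hθ : θ < 1) : 0 < holderConst C Q ρ ε θ := by
  have hmin : 0 < min 1 ρ := lt_min one_pos hρ
  have hθ' : 0 < 1 - θ := by linarith
  unfold holderConst
  positivity

namespace Setting

variable {μ : Measure X} [IsProbabilityMeasure μ] {a : BB X} {S : BB X →L[ℂ] BB X}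
  {m : ℂ → BB X} {A K ρ : ℝ} {L : ℕ}

theorem Sig_le (E : Setting μ a S m A K ρ L) (hK : 0 ≤ K) : Sig a S ≤ A + 2 * Real.sqrt K := by
  have h1 := Real.sqrt_le_sqrt (E.opNorm_le hK)
  have h2 := E.norm_le
  rw [Sig]
  linarith

/-- A spectral parameter in the domain is outside the disc of radius `2 Σ`, or its real part
lies in `I`, or its imaginary part is bounded below. -/
theorem domain_cases {s ε : ℝ} {I : Set ℝ} {z : ℂ} (hz : z ∈ domain s I ε) :
    2 * s ≤ ‖z‖ ∨ ‖z‖ ≤ 2 * s ∧ (z.re ∈ I ∨ ε ≤ z.im) := by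
  rcases le_total (2 * s) ‖z‖ with h | h
  · exact Or.inl h
  refine Or.inr ⟨h, ?_⟩
  by_cases hI : z.re ∈ I
  · exact Or.inl hI
  right
  have h1 := abs_le.1 ((Complex.abs_re_le_norm z).trans h)
  -- Re z lies in [-2s, 2s] \ I, and its distance to z is Im z.
  have h2 := hz.2 z.re ⟨⟨h1.1, h1.2⟩, hI⟩
  have h3 : z - (z.re : ℂ) = (z.im : ℂ) * Complex.I := by
    apply Complex.ext <;> simp
  rwa [h3, norm_mul, Complex.norm_I, mul_one, Complex.norm_real, Real.norm_eq_abs,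
    abs_of_pos hz.1] at h2

theorem norm_le_of_outer (E : Setting μ a S m A K ρ L) {z : ℂ} (hz : 0 < z.im)
    (h : 2 * Sig a S ≤ ‖z‖) : ‖m z‖ ≤ 1 / Real.sqrt (min 1 ρ) := by
  have h1 := E.norm_le_of_two_mul_Sig_le hz h
  have h2 : 0 < Real.sqrt (min 1 ρ) := Real.sqrt_pos.2 (lt_min one_pos E.primitive.pos)
  have h3 := mul_le_mul_of_nonneg_right (Real.sqrt_le_sqrt E.min_le_opNorm) (norm_nonneg (m z))
  rw [le_div_iff₀ h2]
  linarith [mul_nonneg (Real.sqrt_nonneg ‖S‖) (norm_nonneg (m z))]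

/-- Gluing of the bounds in the different regions of the domain, for functions `g u` of `u = m z`
that are Lipschitz continuous. -/
theorem holder (E : Setting μ a S m A K ρ L) (hK : 0 ≤ K) {V : Type*} [NormedAddCommGroup V]
    (g : BB X → V) (hg : ∀ u w, ‖g u - g w‖ ≤ ‖u - w‖) (N : BB X → ℝ)
    (hgN : ∀ u, ‖g u‖ ≤ N u) (hN : ∀ u, N u ≤ ‖u‖) {ε θ C Q : ℝ}
    {I : Set ℝ} (hε : 0 < ε) (hC : 0 < C) (hθ0 : 0 ≤ θ) (hθ : θ < 1) (hQε : 2 / ε ≤ Q)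
    (hQ : ∀ z : ℂ, 0 < z.im → z.re ∈ I → N (m z) ≤ Q)
    (hloc : ∀ z : ℂ, 0 < z.im → ‖z‖ ≤ 2 * (A + 2 * Real.sqrt K) + 1 → N (m z) ≤ Q →
      ∀ᶠ z' in nhds z, ‖g (m z) - g (m z')‖ ≤ C * z.im ^ (-θ) * ‖z - z'‖)
    {z₁ z₂ : ℂ} (h₁ : z₁ ∈ domain (Sig a S) I ε) (h₂ : z₂ ∈ domain (Sig a S) I ε) :
    ‖g (m z₁) - g (m z₂)‖ ≤
      holderConst C Q ρ ε θ * ‖z₁ - z₂‖ ^ (1 - θ) := by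
  have hρ : 0 < min 1 ρ := lt_min one_pos E.primitive.pos
  have hQ0 : 0 < Q := lt_of_lt_of_le (by positivity) hQε
  have hS := E.Sig_le hK
  -- On the domain with parameter ε/2 the third case has Im z ≥ ε/2, hence ‖m‖ ≤ 2/ε ≤ Q.
  have hinner : ∀ z ∈ domain (Sig a S) I (ε / 2), 2 * Sig a S ≤ ‖z‖ ∨
      ‖z‖ ≤ 2 * Sig a S ∧ N (m z) ≤ Q := fun z hz => by
    rcases domain_cases hz with h | ⟨h, h' | h'⟩
    · exact Or.inl h
    · exact Or.inr ⟨h, hQ z hz.1 h'⟩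
    · refine Or.inr ⟨h, (hN _).trans ((E.sol.norm_le E.real E.sp hz.1).trans (le_trans ?_ hQε))⟩
      rw [div_le_div_iff₀ hz.1 hε]
      linarith
  refine holder_of_local (f := fun z => g (m z)) hε (by positivity) (by positivity) hθ0 hθ
    (fun z hz => ?_) (fun z hz => ?_) h₁ h₂
  · have hz0 := hz.1
    have hpow : 0 < z.im ^ (-θ) := Real.rpow_pos_of_pos hz0 _
    have hmin : 0 < 1 / min 1 ρ := by positivity
    rcases hinner z hz with h | ⟨h, h'⟩
    · filter_upwards [E.eventually_of_two_mul_Sig_le hz0 h] with w hw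
      refine (hg _ _).trans (hw.trans (mul_le_mul_of_nonneg_right ?_ (norm_nonneg _)))
      nlinarith [mul_pos hC hpow, mul_pos hmin hpow]
    · filter_upwards [hloc z hz0 (by linarith) h'] with w hw
      refine hw.trans (mul_le_mul_of_nonneg_right ?_ (norm_nonneg _))
      nlinarith [mul_pos hC hpow, mul_pos hmin hpow]
  · have h0 : 0 < 1 / Real.sqrt (min 1 ρ) := by positivity
    rcases hinner z (domain_mono (by linarith) hz) with h | ⟨h, h'⟩
    · exact (hgN _).trans ((hN _).trans ((E.norm_le_of_outer hz.1 h).trans (by linarith)))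
    · exact (hgN _).trans (h'.trans (by linarith))

end Setting

theorem norm_le_of_nnorm_le {m : ℂ → BB X} {I : Set ℝ} {Φ : ℝ}
    (h : nnorm m I ≤ ENNReal.ofReal Φ) {z : ℂ} (hz : 0 < z.im) (hI : z.re ∈ I) :
    ‖m z‖ ≤ max Φ 0 := by
  have h1 := (le_iSup (fun z : {z : ℂ // z.re ∈ I ∧ 0 < z.im} => ‖m z‖ₑ) ⟨z, hI, hz⟩).trans h
  rw [← ofReal_norm] at h1
  rcases ENNReal.ofReal_le_ofReal_iff'.1 h1 with h2 | h2
  · exact h2.trans (le_max_left _ _)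
  · exact h2.trans (le_max_right _ _)

theorem exists_holder_avg (A K ρ : ℝ) (L : ℕ) (ε Λ : ℝ) (hε : 0 < ε) : ∃ C : ℝ, 0 < C ∧
    ∀ (X : Type*) [MeasurableSpace X] (μ : Measure X) [IsProbabilityMeasure μ]
      (a : BB X) (S : BB X →L[ℂ] BB X) (m : ℂ → BB X) (I : Set ℝ),
      (∀ x, (a x).im = 0) → ‖a‖ ≤ A →
      SymmetricPositive μ S → SmoothingWith μ S K → UniformlyPrimitive μ S L ρ →
      IsSolution a S m →
      (∀ z : ℂ, 0 < z.im → z.re ∈ I → ‖BB.toL2 μ (m z)‖ ≤ Λ) →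
      ∀ z₁ ∈ domain (Sig a S) I ε, ∀ z₂ ∈ domain (Sig a S) I ε,
        ‖avg μ (m z₁) - avg μ (m z₂)‖ ≤ C * ‖z₁ - z₂‖ ^ (1 / 13 : ℝ) := by
  by_cases hpar : 0 ≤ A ∧ 0 ≤ K ∧ 0 < ρ ∧ 1 ≤ L
  swap
  -- For inadmissible parameters the hypotheses are contradictory, so any constant serves.
  · refine ⟨1, one_pos, ?_⟩
    intro X _ μ _ a S m I ha haA hS hK hρ
    exact absurd ⟨(norm_nonneg a).trans haA, hK.nonneg, hρ.pos, hρ.one_le⟩ hpar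
  obtain ⟨hA, hK0, hρ0, hL⟩ := hpar
  have hQ : 0 < max Λ (2 / ε) := lt_max_of_lt_right (by positivity)
  obtain ⟨C, hC, h⟩ := exists_local_avg (R := 2 * (A + 2 * Real.sqrt K) + 1) hA hK0 hρ0 hL
    (by positivity) hQ
  refine ⟨holderConst C (max Λ (2 / ε)) ρ ε (12 / 13), holderConst_pos hC hQ hρ0 hε (by norm_num), ?_⟩
  · intro X _ μ _ a S m I ha haA hS hK hρ hm hΛ z₁ h₁ z₂ h₂
    have E : Setting μ a S m A K ρ L := ⟨ha, haA, hS, hK.norm_apply_le, hρ, hm⟩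
    have key := E.holder hK0 (avg μ) (norm_avg_sub_le μ) (fun u => ‖BB.toL2 μ u‖) (norm_avg_le μ)
      (BB.norm_toL2_le_norm μ) (θ := 12 / 13) hε hC (by norm_num) (by norm_num)
      (le_max_right Λ _) (fun z hz hI => (hΛ z hz hI).trans (le_max_left _ _))
      (h X μ a S m E) h₁ h₂
    rw [show (1 : ℝ) - 12 / 13 = 1 / 13 by norm_num] at key
    exact key

theorem exists_holder_norm (A K ρ : ℝ) (L : ℕ) (ε Φ : ℝ) (hε : 0 < ε) : ∃ C : ℝ, 0 < C ∧
    ∀ (X : Type*) [MeasurableSpace X] (μ : Measure X) [IsProbabilityMeasure μ]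
      (a : BB X) (S : BB X →L[ℂ] BB X) (m : ℂ → BB X) (I : Set ℝ),
      (∀ x, (a x).im = 0) → ‖a‖ ≤ A →
      SymmetricPositive μ S → SmoothingWith μ S K → UniformlyPrimitive μ S L ρ →
      IsSolution a S m → nnorm m I ≤ ENNReal.ofReal Φ →
      ∀ z₁ ∈ domain (Sig a S) I ε, ∀ z₂ ∈ domain (Sig a S) I ε,
        ‖m z₁ - m z₂‖ ≤ C * ‖z₁ - z₂‖ ^ (1 / 3 : ℝ) := by
  by_cases hpar : 0 ≤ A ∧ 0 ≤ K ∧ 0 < ρ ∧ 1 ≤ L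
  swap
  · refine ⟨1, one_pos, ?_⟩
    intro X _ μ _ a S m I ha haA hS hK hρ
    exact absurd ⟨(norm_nonneg a).trans haA, hK.nonneg, hρ.pos, hρ.one_le⟩ hpar
  obtain ⟨hA, hK0, hρ0, hL⟩ := hpar
  -- `ENNReal.ofReal` truncates a negative Φ to zero, hence `max Φ 0`; 2/ε covers the points with Im
  -- z ≥ ε/2.
  have hQ : 0 < max (max Φ 0) (2 / ε) := lt_max_of_lt_right (by positivity)
  obtain ⟨C, hC, h⟩ := exists_local_norm (R := 2 * (A + 2 * Real.sqrt K) + 1) hA hK0 hρ0 hL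
    (by positivity) hQ
  refine ⟨holderConst C (max (max Φ 0) (2 / ε)) ρ ε (2 / 3), holderConst_pos hC hQ hρ0 hε (by norm_num), ?_⟩
  · intro X _ μ _ a S m I ha haA hS hK hρ hm hΦ z₁ h₁ z₂ h₂
    have E : Setting μ a S m A K ρ L := ⟨ha, haA, hS, hK.norm_apply_le, hρ, hm⟩
    have key := E.holder hK0 (fun u => u) (fun _ _ => le_rfl) (fun u => ‖u‖) (fun _ => le_rfl)
      (fun _ => le_rfl) (θ := 2 / 3) hε hC (by norm_num) (by norm_num)
      (le_max_right (max Φ 0) _)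
      (fun z hz hI => (norm_le_of_nnorm_le hΦ hz hI).trans (le_max_left _ _))
      (h X μ a S m E) h₁ h₂
    rw [show (1 : ℝ) - 2 / 3 = 1 / 3 by norm_num] at key
    exact key

end QVE

end

theorem mainTheorem11 :
    (∀ (A K ρ : ℝ) (L : ℕ) (ε Λ : ℝ), 0 < ε → ∃ C : ℝ, 0 < C ∧
      ∀ (X : Type*) [MeasurableSpace X] (μ : Measure X) [IsProbabilityMeasure μ]
        (a : QVE.BB X) (S : QVE.BB X →L[ℂ] QVE.BB X) (m : ℂ → QVE.BB X) (I : Set ℝ),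
        (∀ x, (a x).im = 0) → ‖a‖ ≤ A →
        QVE.SymmetricPositive μ S → QVE.SmoothingWith μ S K → QVE.UniformlyPrimitive μ S L ρ →
        QVE.IsSolution a S m → I.OrdConnected →
        (∀ z : ℂ, 0 < z.im → z.re ∈ I → ‖QVE.BB.toL2 μ (m z)‖ ≤ Λ) →
        ∀ z₁ ∈ QVE.domain (QVE.Sig a S) I ε, ∀ z₂ ∈ QVE.domain (QVE.Sig a S) I ε,
          ‖QVE.avg μ (m z₁) - QVE.avg μ (m z₂)‖ ≤ C * ‖z₁ - z₂‖ ^ (1 / 13 : ℝ)) ∧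
    (∀ (A K ρ : ℝ) (L : ℕ) (ε Φ : ℝ), 0 < ε → ∃ C : ℝ, 0 < C ∧
      ∀ (X : Type*) [MeasurableSpace X] (μ : Measure X) [IsProbabilityMeasure μ]
        (a : QVE.BB X) (S : QVE.BB X →L[ℂ] QVE.BB X) (m : ℂ → QVE.BB X) (I : Set ℝ),
        (∀ x, (a x).im = 0) → ‖a‖ ≤ A →
        QVE.SymmetricPositive μ S → QVE.SmoothingWith μ S K → QVE.UniformlyPrimitive μ S L ρ →
        QVE.IsSolution a S m → I.OrdConnected →
        QVE.nnorm m I ≤ ENNReal.ofReal Φ →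
        (∀ z₁ ∈ QVE.domain (QVE.Sig a S) I ε, ∀ z₂ ∈ QVE.domain (QVE.Sig a S) I ε,
          ‖m z₁ - m z₂‖ ≤ C * ‖z₁ - z₂‖ ^ (1 / 3 : ℝ)) ∧
        ∃ M : ℂ → QVE.BB X,
          (∀ z ∈ QVE.domain (QVE.Sig a S) I ε, M z = m z) ∧
          ContinuousOn M (QVE.closedDomain (QVE.Sig a S) I ε) ∧
          ∀ z₁ ∈ QVE.closedDomain (QVE.Sig a S) I ε,
            ∀ z₂ ∈ QVE.closedDomain (QVE.Sig a S) I ε,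
              ‖M z₁ - M z₂‖ ≤ C * ‖z₁ - z₂‖ ^ (1 / 3 : ℝ)) := by
  constructor
  · intro A K ρ L ε Λ hε
    obtain ⟨C, hC, h⟩ := QVE.exists_holder_avg A K ρ L ε Λ hε
    exact ⟨C, hC, fun X _ μ _ a S m I ha haA hS hK hρ hm _ hΛ =>
      h X μ a S m I ha haA hS hK hρ hm hΛ⟩
  · intro A K ρ L ε Φ hε
    obtain ⟨C, hC, h⟩ := QVE.exists_holder_norm A K ρ L ε Φ hε
    refine ⟨C, hC, fun X _ μ _ a S m I ha haA hS hK hρ hm _ hΦ => ?_⟩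
    have hh := h X μ a S m I ha haA hS hK hρ hm hΦ
    exact ⟨hh, QVE.exists_extension (by norm_num) hh⟩
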